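/- Let $\Phi$ be a homogeneous Poisson point process on the plane $\mathbb{R}^2$ with density $\lambda>0$ (a random locally finite set of atoms). For different atoms $x,y$ of a configuration $\varphi$, write $x\to y$ if $y$ minimizes $\|x-z\|$ over $z\in\varphi\setminus\{x\}$. The atoms $x$ and $y$ are mutually nearest neighbours if $x\to y$ and $y\to x$. Let $\varphi^{(2)}$ be the set of atoms of $\varphi$ that are mutually nearest neighbours with some other atom of $\varphi$, and let $\varphi^{(1)}$ be the set of the remaining (single) atoms. For a point $x\in\mathbb{R}^2$ let $\mathbb{P}^{x}$ be the Palm probability of $\Phi$ given an atom at $x$, that is, for any Borel set $B\subset\mathbb{R}^2$ with positive finite area, $$\mathbb{P}^{x}(A)=\frac{1}{\mathbb{E}[\Phi(B)]}\,\mathbb{E}\Big[\sum_{z\in\Phi\cap B}\mathbf 1_A(\Phi-z+x)\Big],$$ where $A$ is a measurable set of configurations, i.e. belongs to the $\sigma$-algebra generated by the numbers of atoms in bounded Borel sets. Then there is a constant $\delta>0$, independent of $\lambda$ and $x$ (and of $B$), namely $$\delta=\frac{1}{2-\gamma}\approx 0.6215,\qquad \gamma=\frac23-\frac{\sqrt3}{2\pi},$$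 such that for every $\lambda>0$ and every $x\in\mathbb{R}^2$ the sets $\{\varphi: x\in\varphi^{(2)}\}$ and $\{\varphi: x\in\varphi^{(1)}\}$ are measurable, and $$\mathbb{P}^{x}\big(\{\varphi : x\in\varphi^{(2)}\}\big)=\delta,\qquad \mathbb{P}^{x}\big(\{\varphi : x\in\varphi^{(1)}\}\big)=1-\delta .$$ -/

import Mathlib

open MeasureTheory ProbabilityTheory Set
open scoped NNReal ENNReal

/-- The Euclidean plane. -/
abbrev Plane : Type := EuclideanSpace ℝ (Fin 2)

/-- A configuration: a locally finite set of points (atoms) of the plane. -/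
structure Config where
  /-- the set of atoms -/
  atoms : Set Plane
  /-- every bounded region holds finitely many atoms -/
  locallyFinite : ∀ B : Set Plane, Bornology.IsBounded B → (atoms ∩ B).Finite

namespace Config

/-- The number of atoms in `B`; used for bounded `B`, where it is the true finite cardinality. -/
noncomputable def count (φ : Config) (B : Set Plane) : ℕ := (φ.atoms ∩ B).ncard

/-- The σ-algebra on configurations generated by the numbers of atoms in bounded Borel sets. -/
noncomputable instance : MeasurableSpace Config :=
  ⨆ B : {B : Set Plane // MeasurableSet B ∧ Bornology.IsBounded B},
    MeasurableSpace.comap (fun φ : Config => φ.count B.1) ⊤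

/-- The configuration translated by the vector `v`. -/
def translate (φ : Config) (v : Plane) : Config where
  atoms := (fun z => z + v) '' φ.atoms
  locallyFinite B hB := by
    have h : Bornology.IsBounded ((fun z => z + -v) '' B) :=
      (isometry_add_right (-v)).lipschitz.isBounded_image hB
    refine ((φ.locallyFinite _ h).image (fun z => z + v)).subset ?_
    rintro _ ⟨⟨z, hz, rfl⟩, hzB⟩
    exact ⟨z, ⟨hz, ⟨z + v, hzB, by simp⟩⟩, rfl⟩

/-- Nearest neighbour relation: `x` and `y` are different atoms of `φ`, and `y` minimizes the
distance to `x` among the atoms of `φ` other than `x`. -/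
def NNR (φ : Config) (x y : Plane) : Prop :=
  x ∈ φ.atoms ∧ y ∈ φ.atoms \ {x} ∧ IsMinOn (fun z => dist x z) (φ.atoms \ {x}) y

/-- Mutually nearest neighbour relation. -/
def MNNR (φ : Config) (x y : Plane) : Prop := φ.NNR x y ∧ φ.NNR y x

/-- The atoms that are in a mutually-nearest-neighbour pair with another atom. -/
def paired (φ : Config) : Set Plane := {x | x ∈ φ.atoms ∧ ∃ y ∈ φ.atoms, φ.MNNR x y}

/-- The single atoms: those in mutually nearest neighbour relation with no atom. -/
def singles (φ : Config) : Set Plane := {x | x ∈ φ.atoms ∧ ∀ y ∈ φ.atoms, ¬ φ.MNNR x y}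

end Config

/-- `Φ` is a homogeneous Poisson point process of density `lam` under `P`: the numbers of atoms in
bounded Borel sets `B` are Poisson with mean `lam * area B`, and they are independent for
pairwise disjoint sets. -/
structure IsPoissonProcess {Ω : Type*} [MeasurableSpace Ω] (P : Measure Ω) (lam : ℝ≥0)
    (Φ : Ω → Config) : Prop where
  measurable : Measurable Φ
  law_count : ∀ B : Set Plane, MeasurableSet B → Bornology.IsBounded B →
    P.map (fun ω => (Φ ω).count B) = poissonMeasure (lam * (volume B).toNNReal)
  indep_count : ∀ (n : ℕ) (B : Fin n → Set Plane), (∀ i, MeasurableSet (B i)) →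
    (∀ i, Bornology.IsBounded (B i)) → Pairwise (fun i j => Disjoint (B i) (B j)) →
    iIndepFun (fun i ω => (Φ ω).count (B i)) P

open Classical in
/-- The Palm probability at the point `x` of an event `A` of configurations, for a stationary point
process `Φ`, computed in a window `B` of positive finite area (its choice does not matter):
`𝔼[∑_{z ∈ Φ ∩ B} 1_A(Φ - z + x)] / 𝔼[Φ(B)]`, that is, each atom `z` of `Φ` in `B` is moved to `x`
together with the whole configuration. -/
noncomputable def palmProb {Ω : Type*} [MeasurableSpace Ω] (P : Measure Ω) (Φ : Ω → Config)
    (B : Set Plane) (x : Plane) (A : Set Config) : ℝ≥0∞ :=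
  (∫⁻ ω, ∑' z : ↥((Φ ω).atoms ∩ B), (if (Φ ω).translate (x - z) ∈ A then 1 else 0) ∂P) /
    (∫⁻ ω, (((Φ ω).atoms ∩ B).encard : ℝ≥0∞) ∂P)

/-- The constant `γ = 2/3 - √3 / (2π)`. -/
noncomputable def mnnGamma : ℝ := 2 / 3 - √3 / (2 * Real.pi)

/-! Atoms `z` and `y` at distance `r` are mutually nearest neighbours exactly when the union of the
open discs of radius `r` about them holds no third atom; its area is `twoDiscArea * r ^ 2`.
Heuristically, two atoms occupy area elements dz and dy with probability lam² dz dy, independently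
of the emptiness of the rest of that union. So the mean number of paired atoms in `B` is lam² ∫_B ∫
exp(-lam · twoDiscArea · |z - y|²) dy dz = lam |B| π / twoDiscArea. Since twoDiscArea = π (2 - γ),
dividing by the mean number lam |B| of atoms gives 1 / (2 - γ). As the neighbour relation commutes
with translations, this quotient is the Palm probability (`palmProb_eq`).

To derive the double integral from counts in disjoint sets alone, the plane is cut into cells of
size h. Certain pairs of cells never outnumber the paired atoms (`encard_certainPairs_le`), and
candidate pairs are at least as many in the lower limit h → 0 (`encard_paired_inter_le_liminf`).
Their means are compared with the Gaussian integral up to errors vanishing with h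
(`le_lintegral_encard_certainPairs`, `lintegral_encard_candidatePairs_le`), and the squeeze is
closed in `aemeasurable_and_lintegral_encard_paired`. -/

/-! ### Area of the union of two discs through each other's centres. -/

/-- The area of the union of two unit discs whose centres are at distance one. -/
noncomputable def twoDiscArea : ℝ := 4 * Real.pi / 3 + √3 / 2

lemma twoDiscArea_pos : 0 < twoDiscArea := by
  unfold twoDiscArea; positivity

lemma integral_sqrt_one_sub_sq_half :
    ∫ u in (-1 : ℝ)..(1 / 2), √(1 - u ^ 2) = √3 / 8 + Real.pi / 3 := by
  have hF : ∀ x ∈ Ioo (-1 : ℝ) (1 / 2),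
      HasDerivAt (fun x => (x * √(1 - x ^ 2) + Real.arcsin x) / 2) (√(1 - x ^ 2)) x := by
    intro x hx
    have h0 : 0 < 1 - x ^ 2 := by nlinarith [hx.1, hx.2]
    have h1 : HasDerivAt (fun x : ℝ => 1 - x ^ 2) (-(2 * x)) x := by
      simpa using (hasDerivAt_pow 2 x).const_sub 1
    have h2 := ((hasDerivAt_id x).mul (h1.sqrt h0.ne')).add
      (Real.hasDerivAt_arcsin (x := x) (by linarith [hx.1]) (by linarith [hx.2]))
    convert! h2.div_const 2 using 1
    have h3 := Real.sq_sqrt h0.le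
    have h4 : √(1 - x ^ 2) ≠ 0 := (Real.sqrt_pos.2 h0).ne'
    simp only [id]
    field_simp
    rw [h3]; ring
  -- Derivatives are needed only in the open interval: the square root and the arcsine are not
  -- differentiable at -1.
  have h := intervalIntegral.integral_eq_sub_of_hasDerivAt_of_le (a := (-1 : ℝ)) (b := 1 / 2)
    (by norm_num) (by fun_prop) hF
    ((by fun_prop : Continuous fun x : ℝ => √(1 - x ^ 2)).intervalIntegrable _ _)
  have h3 : √(1 - (1 / 2 : ℝ) ^ 2) = √3 / 2 := by
    rw [show (1 - (1 / 2 : ℝ) ^ 2) = 3 / 2 ^ 2 by norm_num, Real.sqrt_div (by norm_num)]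
    simp
  have h4 : Real.arcsin (1 / 2) = Real.pi / 6 := by
    rw [← Real.sin_pi_div_six]
    exact Real.arcsin_sin (by linarith [Real.pi_pos]) (by linarith [Real.pi_pos])
  rw [h, h3, h4, Real.arcsin_neg_one]
  norm_num
  ring

lemma volume_union_discs_prod :
    volume {p : ℝ × ℝ | p.1 ^ 2 + p.2 ^ 2 < 1 ∨ (p.1 - 1) ^ 2 + p.2 ^ 2 < 1} =
      ENNReal.ofReal twoDiscArea := by
  -- A vertical slice of the union is the longer of the two slices. At `u = 2` the slice is empty,
  -- so the half-open interval is harmless.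
  set g : ℝ → ℝ := fun u => √(max (1 - u ^ 2) (1 - (u - 1) ^ 2)) with hg
  have hgc : Continuous g := by fun_prop
  have hset : {p : ℝ × ℝ | p.1 ^ 2 + p.2 ^ 2 < 1 ∨ (p.1 - 1) ^ 2 + p.2 ^ 2 < 1} =
      regionBetween (-g) g (Ioc (-1) 2) := by
    ext ⟨u, v⟩
    simp only [regionBetween, Pi.neg_apply, mem_ofPred_eq, mem_Ioo, ← abs_lt, hg,
      Real.lt_sqrt (abs_nonneg v), sq_abs, lt_max_iff, mem_Ioc]
    constructor
    · rintro (h | h)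
      · exact ⟨⟨by nlinarith [sq_nonneg v], by nlinarith [sq_nonneg v]⟩, Or.inl (by linarith)⟩
      · exact ⟨⟨by nlinarith [sq_nonneg v], by nlinarith [sq_nonneg v]⟩, Or.inr (by linarith)⟩
    · rintro ⟨-, h | h⟩
      · left; linarith
      · right; linarith
  rw [hset, Measure.volume_eq_prod, volume_regionBetween_eq_integral
    (hgc.neg.integrableOn_Ioc) hgc.integrableOn_Ioc measurableSet_Ioc
    (fun x _ => neg_le_self (Real.sqrt_nonneg _))]
  congr 1
  rw [← intervalIntegral.integral_of_le (by norm_num)]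
  simp only [Pi.sub_apply, Pi.neg_apply, sub_neg_eq_add, ← two_mul]
  rw [intervalIntegral.integral_const_mul, ← intervalIntegral.integral_add_adjacent_intervals
    (hgc.intervalIntegrable (-1) (1 / 2)) (hgc.intervalIntegrable (1 / 2) 2)]
  have h1 : ∫ u in (-1 : ℝ)..(1 / 2), g u = √3 / 8 + Real.pi / 3 := by
    rw [← integral_sqrt_one_sub_sq_half]
    refine intervalIntegral.integral_congr fun u hu => ?_
    rw [uIcc_of_le (by norm_num)] at hu
    simp only [hg]
    rw [max_eq_left (by nlinarith [hu.2])]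
  have h2 : ∫ u in (1 / 2 : ℝ)..2, g u = √3 / 8 + Real.pi / 3 := by
    have hsym : ∀ u, g (1 - u) = g u := fun u => by
      simp only [hg]
      rw [max_comm]
      ring_nf
    rw [← h1, ← intervalIntegral.integral_congr fun u _ => hsym u,
      intervalIntegral.integral_comp_sub_left]
    norm_num
  rw [h1, h2, twoDiscArea]
  ring

/-- The reflection exchanging `v` and the first basis vector preserves area and reduces the claim to
coordinates. -/
lemma volume_union_unit_balls {v : Plane} (hv : ‖v‖ = 1) :
    volume (Metric.ball (0 : Plane) 1 ∪ Metric.ball v 1) = ENNReal.ofReal twoDiscArea := by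
  set e : Plane := !₂[1, 0] with he
  have hne : ‖e‖ = 1 := by simp [he, EuclideanSpace.norm_eq]
  set R := Submodule.reflection (ℝ ∙ (v - e))ᗮ with hR
  have hRv : R v = e := Submodule.reflection_sub (by rw [hv, hne])
  have h1 : R ⁻¹' (Metric.ball (0 : Plane) 1 ∪ Metric.ball e 1) =
      Metric.ball (0 : Plane) 1 ∪ Metric.ball v 1 := by
    rw [preimage_union, LinearIsometryEquiv.preimage_ball, LinearIsometryEquiv.preimage_ball,
      ← hRv, LinearIsometryEquiv.symm_apply_apply, map_zero]
  rw [← h1, R.measurePreserving.measure_preimage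
    (Metric.isOpen_ball.union Metric.isOpen_ball).measurableSet.nullMeasurableSet]
  have hT := (volume_preserving_finTwoArrow ℝ).comp (PiLp.volume_preserving_ofLp (Fin 2))
  rw [← volume_union_discs_prod, ← hT.measure_preimage]
  · congr 1
    ext w
    have hw : ∀ a : Plane, w ∈ Metric.ball a 1 ↔ (w 0 - a 0) ^ 2 + (w 1 - a 1) ^ 2 < 1 := by
      intro a
      rw [Metric.mem_ball, EuclideanSpace.dist_eq, Real.sqrt_lt' one_pos]
      simp [Fin.sum_univ_two, Real.dist_eq, sq_abs]
    simp [hw, he, MeasurableEquiv.finTwoArrow]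
  · have h1 : IsOpen {p : ℝ × ℝ | p.1 ^ 2 + p.2 ^ 2 < 1} := isOpen_lt (by fun_prop) (by fun_prop)
    have h2 : IsOpen {p : ℝ × ℝ | (p.1 - 1) ^ 2 + p.2 ^ 2 < 1} :=
      isOpen_lt (by fun_prop) (by fun_prop)
    exact (h1.union h2).measurableSet.nullMeasurableSet

open scoped Pointwise in
lemma volume_union_balls (a b : Plane) :
    volume (Metric.ball a (dist a b) ∪ Metric.ball b (dist a b)) =
      ENNReal.ofReal (twoDiscArea * dist a b ^ 2) := by
  rcases eq_or_ne a b with rfl | hab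
  · simp
  set r := dist a b with hr
  have hr0 : 0 < r := dist_pos.2 hab
  have hn : ‖r⁻¹ • (b - a)‖ = 1 := by
    rw [norm_smul, ← dist_eq_norm, dist_comm b a, ← hr, norm_inv, Real.norm_of_nonneg hr0.le,
      inv_mul_cancel₀ hr0.ne']
  have h1 : Metric.ball a r ∪ Metric.ball b r =
      (fun w => w + -a) ⁻¹' (r • (Metric.ball (0 : Plane) 1 ∪ Metric.ball (r⁻¹ • (b - a)) 1)) := by
    rw [Set.smul_set_union, smul_ball hr0.ne', smul_ball hr0.ne', smul_inv_smul₀ hr0.ne',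
      Real.norm_of_nonneg hr0.le]
    ext w
    simp [dist_eq_norm, sub_eq_add_neg, add_comm]
  rw [h1, measure_preimage_add_right, Measure.addHaar_smul, volume_union_unit_balls hn,
    ← ENNReal.ofReal_mul (abs_nonneg _)]
  simp [mul_comm]

lemma volume_real_ball {a : Plane} {r : ℝ} (hr : 0 ≤ r) :
    volume.real (Metric.ball a r) = Real.pi * r ^ 2 := by
  rw [measureReal_def, EuclideanSpace.volume_ball_fin_two]
  simp [hr, Real.pi_pos.le, mul_comm]

lemma volume_real_closedBall {a : Plane} {r : ℝ} (hr : 0 ≤ r) :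
    volume.real (Metric.closedBall a r) = Real.pi * r ^ 2 := by
  rw [measureReal_def, EuclideanSpace.volume_closedBall_fin_two]
  simp [hr, Real.pi_pos.le, mul_comm]

lemma volume_real_union_balls (a b : Plane) :
    volume.real (Metric.ball a (dist a b) ∪ Metric.ball b (dist a b)) =
      twoDiscArea * dist a b ^ 2 := by
  rw [measureReal_def, volume_union_balls, ENNReal.toReal_ofReal]
  have := twoDiscArea_pos
  positivity

lemma volume_real_ball_diff_ball_le (a : Plane) {r s : ℝ} (hr : 0 ≤ r) (hs : 0 ≤ s) :
    volume.real (Metric.ball a r \ Metric.ball a (r - s)) ≤ 2 * Real.pi * r * s := by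
  have hpi := Real.pi_pos
  rcases le_total s r with h | h
  · rw [measureReal_sdiff (Metric.ball_subset_ball (by linarith)) measurableSet_ball
      measure_ball_lt_top.ne, volume_real_ball hr, volume_real_ball (by linarith)]
    nlinarith [mul_nonneg hpi.le (sq_nonneg s)]
  · rw [Metric.ball_eq_empty.2 (by linarith : r - s ≤ 0), sdiff_empty, volume_real_ball hr]
    nlinarith [mul_nonneg hpi.le (mul_nonneg hr (sub_nonneg.2 h)), mul_nonneg hpi.le
      (mul_nonneg hr hs)]

lemma volume_real_closedBall_diff_ball_le (a : Plane) {r s : ℝ} (hr : 0 ≤ r) (hs : 0 ≤ s) :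
    volume.real (Metric.closedBall a (r + s) \ Metric.ball a r) ≤
      2 * Real.pi * r * s + Real.pi * s ^ 2 := by
  rw [measureReal_sdiff ((Metric.ball_subset_ball (by linarith)).trans
    Metric.ball_subset_closedBall) measurableSet_ball
      measure_closedBall_lt_top.ne, volume_real_ball hr, volume_real_closedBall (by linarith)]
  nlinarith

/-! ### Discs about perturbed centres. -/

/-- The union of the open discs around `a` and `b` whose radius falls short of their distance
by `3 * h`. -/
def innerDiscs (h : ℝ) (a b : Plane) : Set Plane :=
  Metric.ball a (dist a b - 3 * h) ∪ Metric.ball b (dist a b - 3 * h)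

/-- The union of the closed discs around `a` and `b` whose radius exceeds their distance
by `3 * h`. -/
def outerDiscs (h : ℝ) (a b : Plane) : Set Plane :=
  Metric.closedBall a (dist a b + 3 * h) ∪ Metric.closedBall b (dist a b + 3 * h)

section Discs

variable {h : ℝ} {a b z y : Plane}

lemma measurableSet_innerDiscs : MeasurableSet (innerDiscs h a b) :=
  measurableSet_ball.union measurableSet_ball

lemma measurableSet_outerDiscs : MeasurableSet (outerDiscs h a b) :=
  measurableSet_closedBall.union measurableSet_closedBall

lemma isBounded_innerDiscs : Bornology.IsBounded (innerDiscs h a b) :=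
  Metric.isBounded_ball.union Metric.isBounded_ball

lemma isBounded_outerDiscs : Bornology.IsBounded (outerDiscs h a b) :=
  Metric.isBounded_closedBall.union Metric.isBounded_closedBall

lemma abs_dist_sub_dist_le (hz : dist z a ≤ h) (hy : dist y b ≤ h) :
    |dist a b - dist z y| ≤ 2 * h := by
  have := dist_dist_dist_le a b z y
  rw [Real.dist_eq, dist_comm a z, dist_comm b y] at this
  linarith

/-- The margin `3 * h` pays for `2 * h` of change in the distance and `h` for moving each centre. -/
lemma innerDiscs_subset (hz : dist z a ≤ h) (hy : dist y b ≤ h) :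
    innerDiscs h a b ⊆ Metric.ball z (dist z y) ∪ Metric.ball y (dist z y) := by
  have hd := abs_le.1 (abs_dist_sub_dist_le hz hy)
  refine union_subset_union (Metric.ball_subset_ball' ?_) (Metric.ball_subset_ball' ?_)
  · rw [dist_comm a z]; linarith
  · rw [dist_comm b y]; linarith

/-- A loss of `6 * h` is the margin `3 * h`, plus `2 * h` for the distance and `h` for the centre.
-/
lemma subset_innerDiscs (hz : dist z a ≤ h) (hy : dist y b ≤ h) :
    Metric.ball z (dist z y - 6 * h) ∪ Metric.ball y (dist z y - 6 * h) ⊆ innerDiscs h a b := by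
  have hd := abs_le.1 (abs_dist_sub_dist_le hz hy)
  refine union_subset_union (Metric.ball_subset_ball' ?_) (Metric.ball_subset_ball' ?_) <;> linarith

lemma subset_outerDiscs (hz : dist z a ≤ h) (hy : dist y b ≤ h) :
    Metric.closedBall z (dist z y) ∪ Metric.closedBall y (dist z y) ⊆ outerDiscs h a b := by
  have hd := abs_le.1 (abs_dist_sub_dist_le hz hy)
  refine union_subset_union (Metric.closedBall_subset_closedBall' ?_)
    (Metric.closedBall_subset_closedBall' ?_) <;> linarith

lemma le_volume_real_innerDiscs_diff (hh : 0 ≤ h) (hz : dist z a ≤ h) (hy : dist y b ≤ h)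
    {S : Set Plane} (hS : S ⊆ Metric.closedBall a h ∪ Metric.closedBall b h) :
    (twoDiscArea - 12 * Real.pi * h) * dist z y ^ 2 - (12 * Real.pi * h + 2 * Real.pi * h ^ 2) ≤
      volume.real (innerDiscs h a b \ S) := by
  set r := dist z y with hr
  have hr0 : 0 ≤ r := dist_nonneg
  have hd := abs_le.1 (abs_dist_sub_dist_le hz hy)
  have hsub : Metric.ball z r ∪ Metric.ball y r ⊆ (innerDiscs h a b \ S) ∪
      ((Metric.closedBall a h ∪ Metric.closedBall b h) ∪
        ((Metric.ball z r \ Metric.ball z (r - 6 * h)) ∪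
          (Metric.ball y r \ Metric.ball y (r - 6 * h)))) := by
    have h1 := subset_innerDiscs hz hy
    intro w hw
    by_cases hwS : w ∈ S
    · exact Or.inr (Or.inl (hS hwS))
    by_cases hw1 : w ∈ Metric.ball z (r - 6 * h)
    · exact Or.inl ⟨h1 (Or.inl hw1), hwS⟩
    by_cases hw2 : w ∈ Metric.ball y (r - 6 * h)
    · exact Or.inl ⟨h1 (Or.inr hw2), hwS⟩
    rcases hw with hw | hw
    · exact Or.inr (Or.inr (Or.inl ⟨hw, hw1⟩))
    · exact Or.inr (Or.inr (Or.inr ⟨hw, hw2⟩))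
  have hfin : Bornology.IsBounded ((innerDiscs h a b \ S) ∪
      ((Metric.closedBall a h ∪ Metric.closedBall b h) ∪
        ((Metric.ball z r \ Metric.ball z (r - 6 * h)) ∪
          (Metric.ball y r \ Metric.ball y (r - 6 * h))))) :=
    (isBounded_innerDiscs.subset sdiff_subset).union
      ((Metric.isBounded_closedBall.union Metric.isBounded_closedBall).union
        ((Metric.isBounded_ball.subset sdiff_subset).union
          (Metric.isBounded_ball.subset sdiff_subset)))
  have h0 := measureReal_mono hsub hfin.measure_lt_top.ne (μ := volume)
  rw [volume_real_union_balls] at h0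
  have h1 := h0.trans ((measureReal_union_le _ _).trans (add_le_add_right
    ((measureReal_union_le _ _).trans (add_le_add (measureReal_union_le _ _)
      (measureReal_union_le _ _))) _))
  rw [volume_real_closedBall hh, volume_real_closedBall hh] at h1
  have h2 := volume_real_ball_diff_ball_le z hr0 (by linarith : 0 ≤ 6 * h)
  have h3 := volume_real_ball_diff_ball_le y hr0 (by linarith : 0 ≤ 6 * h)
  -- The error linear in `r` is absorbed into `r ^ 2 + 1`, so that the bound stays a Gaussian
  -- exponent that can be integrated exactly.
  have h4 : 2 * Real.pi * r * (6 * h) ≤ 6 * Real.pi * h * (r ^ 2 + 1) := by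
    have : 0 ≤ 6 * Real.pi * h := by positivity
    nlinarith [mul_nonneg this (sq_nonneg (r - 1))]
  linarith

lemma volume_real_outerDiscs_le (hh : 0 ≤ h) (hz : dist z a ≤ h) (hy : dist y b ≤ h) :
    volume.real (outerDiscs h a b) ≤
      (twoDiscArea + 12 * Real.pi * h) * dist z y ^ 2 +
        (12 * Real.pi * h + 72 * Real.pi * h ^ 2) := by
  set r := dist z y with hr
  have hr0 : 0 ≤ r := dist_nonneg
  have hd := abs_le.1 (abs_dist_sub_dist_le hz hy)
  have hsub : outerDiscs h a b ⊆ (Metric.ball z r ∪ Metric.ball y r) ∪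
        ((Metric.closedBall z (r + 6 * h) \ Metric.ball z r) ∪
          (Metric.closedBall y (r + 6 * h) \ Metric.ball y r)) := by
    have h1 : Metric.closedBall a (dist a b + 3 * h) ⊆ Metric.closedBall z (r + 6 * h) :=
      Metric.closedBall_subset_closedBall' (by rw [dist_comm a z]; linarith)
    have h2 : Metric.closedBall b (dist a b + 3 * h) ⊆ Metric.closedBall y (r + 6 * h) :=
      Metric.closedBall_subset_closedBall' (by rw [dist_comm b y]; linarith)
    intro w hw
    by_cases hw1 : w ∈ Metric.ball z r
    · exact Or.inl (Or.inl hw1)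
    by_cases hw2 : w ∈ Metric.ball y r
    · exact Or.inl (Or.inr hw2)
    rcases hw with hw | hw
    · exact Or.inr (Or.inl ⟨h1 hw, hw1⟩)
    · exact Or.inr (Or.inr ⟨h2 hw, hw2⟩)
  have hfin : Bornology.IsBounded ((Metric.ball z r ∪ Metric.ball y r) ∪
        ((Metric.closedBall z (r + 6 * h) \ Metric.ball z r) ∪
          (Metric.closedBall y (r + 6 * h) \ Metric.ball y r))) :=
    (Metric.isBounded_ball.union Metric.isBounded_ball).union
      ((Metric.isBounded_closedBall.subset sdiff_subset).union
        (Metric.isBounded_closedBall.subset sdiff_subset))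
  have h0 := measureReal_mono hsub hfin.measure_lt_top.ne (μ := volume)
  have h1 := h0.trans ((measureReal_union_le _ _).trans (add_le_add_right
    (measureReal_union_le _ _) _))
  rw [volume_real_union_balls] at h1
  have h2 := volume_real_closedBall_diff_ball_le z hr0 (by linarith : 0 ≤ 6 * h)
  have h3 := volume_real_closedBall_diff_ball_le y hr0 (by linarith : 0 ≤ 6 * h)
  have h4 : 2 * Real.pi * r * (6 * h) ≤ 6 * Real.pi * h * (r ^ 2 + 1) := by
    have : 0 ≤ 6 * Real.pi * h := by positivity
    nlinarith [mul_nonneg this (sq_nonneg (r - 1))]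
  linarith

end Discs

/-! ### The constant and its numerical value. -/

lemma twoDiscArea_eq : twoDiscArea = Real.pi * (2 - mnnGamma) := by
  have := Real.pi_pos
  unfold twoDiscArea mnnGamma
  field_simp
  ring

lemma abs_one_div_two_sub_mnnGamma_sub_lt : |1 / (2 - mnnGamma) - 0.6215| < 0.00005 := by
  have h1 := Real.pi_gt_d6
  have h2 := Real.pi_lt_d6
  have h3 : 1.7320 < √3 := Real.lt_sqrt_of_sq_lt (by norm_num)
  have h4 : √3 < 1.7321 := (Real.sqrt_lt' (by norm_num)).2 (by norm_num)
  have h5 : 0.27564 < √3 / (2 * Real.pi) := by rw [lt_div_iff₀ (by positivity)]; nlinarith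
  have h6 : √3 / (2 * Real.pi) < 0.27568 := by rw [div_lt_iff₀ (by positivity)]; nlinarith
  have h7 : 0 < 2 - mnnGamma := by unfold mnnGamma; linarith
  rw [abs_lt]
  constructor
  · rw [lt_sub_iff_add_lt, lt_div_iff₀ h7]
    unfold mnnGamma; nlinarith
  · rw [sub_lt_iff_lt_add, div_lt_iff₀ h7]
    unfold mnnGamma; nlinarith

/-! ### Measurability and translation invariance of the paired and single atoms. -/

namespace Config

lemma measurable_count {B : Set Plane} (hB : MeasurableSet B) (hb : Bornology.IsBounded B) :
    Measurable fun φ : Config => φ.count B := by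
  have h : MeasurableSpace.comap (fun φ : Config => φ.count B) ⊤ ≤
      (inferInstance : MeasurableSpace Config) :=
    le_iSup (fun B : {B : Set Plane // MeasurableSet B ∧ Bornology.IsBounded B} =>
      MeasurableSpace.comap (fun φ : Config => φ.count B.1) ⊤) ⟨B, hB, hb⟩
  exact measurable_iff_comap_le.2 h

lemma count_eq_zero_iff {φ : Config} {B : Set Plane} (hb : Bornology.IsBounded B) :
    φ.count B = 0 ↔ ∀ z ∈ φ.atoms, z ∉ B := by
  rw [count, ncard_eq_zero (φ.locallyFinite B hb), eq_empty_iff_forall_notMem]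
  simp

lemma one_le_count_iff {φ : Config} {B : Set Plane} (hb : Bornology.IsBounded B) :
    1 ≤ φ.count B ↔ ∃ z ∈ φ.atoms, z ∈ B := by
  rw [Nat.one_le_iff_ne_zero, Ne, count_eq_zero_iff hb]
  push Not
  rfl

lemma exists_of_count_eq_one {φ : Config} {B : Set Plane} (h : φ.count B = 1) :
    ∃ z ∈ φ.atoms, z ∈ B ∧ ∀ w ∈ φ.atoms, w ∈ B → w = z := by
  obtain ⟨z, hz⟩ := ncard_eq_one.1 h
  have hz' : z ∈ φ.atoms ∩ B := hz ▸ mem_singleton z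
  exact ⟨z, hz'.1, hz'.2, fun w hw hwB => hz.subset ⟨hw, hwB⟩⟩

lemma nnr_iff {φ : Config} {x y : Plane} : φ.NNR x y ↔ x ∈ φ.atoms ∧ y ∈ φ.atoms ∧ y ≠ x ∧
    ∀ z ∈ φ.atoms, z ≠ x → dist x y ≤ dist x z := by
  simp only [NNR, isMinOn_iff, mem_sdiff, mem_singleton_iff, and_imp, and_assoc]

/-- An atom in either open disc would be strictly closer to its centre than the partner; this turns
the relation into emptiness of a region. -/
lemma mnnr_iff {φ : Config} {x y : Plane} : φ.MNNR x y ↔ x ∈ φ.atoms ∧ y ∈ φ.atoms ∧ y ≠ x ∧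
    ∀ z ∈ φ.atoms, z ∈ Metric.ball x (dist x y) ∪ Metric.ball y (dist x y) → z = x ∨ z = y := by
  simp only [MNNR, nnr_iff, mem_union, Metric.mem_ball]
  constructor
  · rintro ⟨⟨hx, hy, hne, h1⟩, -, -, -, h2⟩
    refine ⟨hx, hy, hne, fun z hz h => ?_⟩
    by_contra! hzxy
    have h1' := h1 z hz hzxy.1
    have h2' := h2 z hz hzxy.2
    rw [dist_comm y x] at h2'
    rw [dist_comm z x, dist_comm z y] at h
    rcases h with h | h <;> linarith
  · rintro ⟨hx, hy, hne, h⟩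
    refine ⟨⟨hx, hy, hne, fun z hz hzx => ?_⟩, hy, hx, hne.symm, fun z hz hzy => ?_⟩
    · by_contra! hlt
      rcases h z hz (Or.inl (by rwa [dist_comm])) with rfl | rfl
      · exact hzx rfl
      · exact lt_irrefl _ hlt
    · by_contra! hlt
      rcases h z hz (Or.inr (by rwa [dist_comm, dist_comm x y])) with rfl | rfl
      · exact lt_irrefl _ hlt
      · exact hzy rfl

lemma mem_paired_iff {φ : Config} {x : Plane} : x ∈ φ.paired ↔ ∃ y, φ.MNNR x y :=
  ⟨fun ⟨_, y, _, h⟩ => ⟨y, h⟩, fun ⟨y, h⟩ => ⟨h.1.1, y, h.1.2.1.1, h⟩⟩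

lemma mem_singles_iff {φ : Config} {x : Plane} : x ∈ φ.singles ↔ x ∈ φ.atoms ∧ x ∉ φ.paired := by
  rw [mem_paired_iff]
  exact ⟨fun ⟨h, h'⟩ => ⟨h, fun ⟨y, hy⟩ => h' y hy.1.2.1.1 hy⟩,
    fun ⟨h, h'⟩ => ⟨h, fun y _ hy => h' ⟨y, hy⟩⟩⟩

/-- This expresses pairing through countably many counts: the unknown partner is located by a ball
of radius `1 / (n + 1)` about a point of a dense sequence, and emptiness is tested on the shrunken
discs. -/
lemma mem_paired_iff_count {φ : Config} {x : Plane} : x ∈ φ.paired ↔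
    1 ≤ φ.count {x} ∧ ∃ R : ℕ, ∀ n : ℕ, ∃ k : ℕ,
      1 ≤ φ.count ((Metric.ball (TopologicalSpace.denseSeq Plane k) (1 / (n + 1)) ∩
        Metric.ball x R) \ {x}) ∧
      φ.count (innerDiscs (1 / (n + 1)) x (TopologicalSpace.denseSeq Plane k) \
        ({x} ∪ Metric.ball (TopologicalSpace.denseSeq Plane k) (1 / (n + 1)))) = 0 := by
  have hb1 : ∀ (n k : ℕ) (R : ℕ), Bornology.IsBounded
      ((Metric.ball (TopologicalSpace.denseSeq Plane k) (1 / (n + 1 : ℝ)) ∩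
        Metric.ball x R) \ {x}) := fun n k R =>
    Metric.isBounded_ball.subset (sdiff_subset.trans inter_subset_left)
  have hb2 : ∀ n k : ℕ, Bornology.IsBounded (innerDiscs (1 / (n + 1 : ℝ)) x
      (TopologicalSpace.denseSeq Plane k) \
        ({x} ∪ Metric.ball (TopologicalSpace.denseSeq Plane k) (1 / (n + 1 : ℝ)))) := fun n k =>
    isBounded_innerDiscs.subset sdiff_subset
  simp only [one_le_count_iff (hb1 _ _ _), count_eq_zero_iff (hb2 _ _),
    one_le_count_iff Bornology.isBounded_singleton, mem_paired_iff, mnnr_iff]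
  constructor
  · rintro ⟨y, hx, hy, hne, hxy⟩
    obtain ⟨R, hR⟩ := exists_nat_gt (dist y x)
    refine ⟨⟨x, hx, rfl⟩, R, fun n => ?_⟩
    have hn : (0 : ℝ) < 1 / (n + 1) := by positivity
    obtain ⟨k, hk⟩ := (TopologicalSpace.denseRange_denseSeq Plane).exists_dist_lt y hn
    refine ⟨k, ⟨y, hy, ⟨hk, hR⟩, hne⟩, fun z hz hzmem => hzmem.2 ?_⟩
    rcases hxy z hz (innerDiscs_subset ((dist_self x).trans_le hn.le) hk.le hzmem.1) with rfl | rfl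
    · exact Or.inl rfl
    · exact Or.inr hk
  · rintro ⟨⟨x', hx, hx'⟩, R, h⟩
    obtain rfl : x' = x := hx'
    choose k hk1 hk2 using h
    choose y hy hyk using hk1
    have hfin : Finite ↥(φ.atoms ∩ Metric.ball x' R) :=
      (φ.locallyFinite _ Metric.isBounded_ball).to_subtype
    -- The bound `R` leaves finitely many possible partners, so one atom `w` serves infinitely many
    -- `n`.
    obtain ⟨⟨w, hw⟩, hinf⟩ := Finite.exists_infinite_fiber
      (fun n => (⟨y n, hy n, (hyk n).1.2⟩ : ↥(φ.atoms ∩ Metric.ball x' R)))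
    have hinf' : {n | y n = w}.Infinite := by
      rw [← infinite_coe_iff]
      convert! hinf using 2
      ext n
      exact (Subtype.ext_iff (a1 := ⟨y n, hy n, (hyk n).1.2⟩) (a2 := ⟨w, hw⟩)).symm
    obtain ⟨n₀, hn₀⟩ := hinf'.nonempty
    have hwx : w ≠ x' := by
      rw [← hn₀]
      exact (hyk n₀).2
    refine ⟨w, hx, hw.1, hwx, fun z hz hzb => ?_⟩
    by_contra! hne
    have hslack : ∃ ε > 0, z ∈ Metric.ball x' (dist x' w - ε) ∪ Metric.ball w (dist x' w - ε) := by
      simp only [mem_union, Metric.mem_ball] at hzb ⊢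
      rcases hzb with hzb | hzb
      · exact ⟨(dist x' w - dist z x') / 2, by linarith, Or.inl (by linarith)⟩
      · exact ⟨(dist x' w - dist z w) / 2, by linarith, Or.inr (by linarith)⟩
    obtain ⟨ε, hε, hzε⟩ := hslack
    -- Below `ε / 6` the shrunken discs still contain `z`; below half of `dist z w` the ball removed
    -- around the partner does not.
    obtain ⟨N, hN⟩ := exists_nat_one_div_lt
      (lt_min (by linarith : 0 < ε / 6) (half_pos (dist_pos.2 hne.2)))
    obtain ⟨n, hn, hNn⟩ := hinf'.exists_gt N
    have hn : y n = w := hn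
    have hnN : (1 : ℝ) / (n + 1) < min (ε / 6) (dist z w / 2) :=
      (Nat.one_div_le_one_div hNn.le).trans_lt hN
    have h1 := hnN.trans_le (min_le_left _ _)
    have h2 := hnN.trans_le (min_le_right _ _)
    have h3 : dist w (TopologicalSpace.denseSeq Plane (k n)) < 1 / (n + 1) := hn ▸ (hyk n).1.1
    refine hk2 n z hz ⟨subset_innerDiscs (z := x') (y := w) ?_ h3.le ?_, ?_⟩
    · rw [dist_self]; positivity
    · exact union_subset_union (Metric.ball_subset_ball (by linarith))
        (Metric.ball_subset_ball (by linarith)) hzε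
    · rintro (h | h)
      · exact hne.1 h
      · rw [Metric.mem_ball] at h
        have := dist_triangle_right z w (TopologicalSpace.denseSeq Plane (k n))
        linarith

lemma measurableSet_mem_atoms (x : Plane) : MeasurableSet {φ : Config | x ∈ φ.atoms} := by
  have h : {φ : Config | x ∈ φ.atoms} = (fun φ : Config => φ.count {x}) ⁻¹' Ici 1 := by
    ext φ
    simp [one_le_count_iff Bornology.isBounded_singleton]
  rw [h]
  exact measurable_count (measurableSet_singleton x) Bornology.isBounded_singleton measurableSet_Ici

lemma measurableSet_mem_paired (x : Plane) : MeasurableSet {φ : Config | x ∈ φ.paired} := by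
  simp only [mem_paired_iff_count]
  refine MeasurableSet.inter ?_ (measurableSet_setOfPred.2 (Measurable.exists fun R =>
    Measurable.forall fun n => Measurable.exists fun k =>
      measurableSet_setOfPred.1 (MeasurableSet.inter ?_ ?_)))
  · exact measurable_count (measurableSet_singleton x) Bornology.isBounded_singleton
      measurableSet_Ici
  · exact measurable_count ((measurableSet_ball.inter measurableSet_ball).diff
      (measurableSet_singleton x))
      (Metric.isBounded_ball.subset (sdiff_subset.trans inter_subset_left)) measurableSet_Ici
  · exact measurable_count (measurableSet_innerDiscs.diff
      ((measurableSet_singleton x).union measurableSet_ball))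
      (isBounded_innerDiscs.subset sdiff_subset) (measurableSet_singleton 0)

lemma measurableSet_mem_singles (x : Plane) : MeasurableSet {φ : Config | x ∈ φ.singles} := by
  simp only [mem_singles_iff]
  exact (measurableSet_mem_atoms x).inter (measurableSet_mem_paired x).compl

lemma mnnr_translate_iff {φ : Config} {v x y : Plane} :
    (φ.translate v).MNNR (x + v) (y + v) ↔ φ.MNNR x y := by
  simp only [mnnr_iff]
  rw [← (Equiv.addRight v).forall_congr_right]
  simp [translate]

lemma mem_paired_translate_iff {φ : Config} {x z : Plane} :
    x ∈ (φ.translate (x - z)).paired ↔ z ∈ φ.paired := by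
  simp only [mem_paired_iff]
  rw [← (Equiv.addRight (x - z)).exists_congr_right]
  simpa using exists_congr fun y => mnnr_translate_iff (φ := φ) (v := x - z) (x := z) (y := y)

lemma mem_singles_translate_iff {φ : Config} {x z : Plane} :
    x ∈ (φ.translate (x - z)).singles ↔ z ∈ φ.singles := by
  rw [mem_singles_iff, mem_singles_iff, mem_paired_translate_iff]
  simp [translate]

end Config

/-! ### Poisson probabilities of counts in disjoint sets. -/

lemma poissonMeasure_zero (r : ℝ≥0) : poissonMeasure r {0} = ENNReal.ofReal (Real.exp (-r)) := by
  simp [poissonMeasure_singleton]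

lemma poissonMeasure_one (r : ℝ≥0) :
    poissonMeasure r {1} = r * ENNReal.ofReal (Real.exp (-r)) := by
  simp [poissonMeasure_singleton, mul_comm]

lemma poissonMeasure_Ici_one_le (r : ℝ≥0) : poissonMeasure r (Ici 1) ≤ r := by
  have h : (Ici 1 : Set ℕ) = {0}ᶜ := by
    ext n
    simp [Nat.one_le_iff_ne_zero]
  rw [h, prob_compl_eq_one_sub (measurableSet_singleton 0), poissonMeasure_zero,
    ← ENNReal.ofReal_one, ← ENNReal.ofReal_sub _ (Real.exp_nonneg _), ← ENNReal.ofReal_coe_nnreal]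
  exact ENNReal.ofReal_le_ofReal (by linarith [Real.add_one_le_exp (-(r : ℝ))])

/-- The weights satisfy (n + 1) p(n + 1) = r p(n), and the p(n) sum to 1. -/
lemma lintegral_natCast_poissonMeasure (r : ℝ≥0) :
    ∫⁻ n : ℕ, (n : ℝ≥0∞) ∂poissonMeasure r = r := by
  have hsucc : ∀ n : ℕ, ((n + 1 : ℕ) : ℝ≥0∞) * poissonMeasure r {n + 1} =
      r * poissonMeasure r {n} := by
    intro n
    rw [poissonMeasure_singleton, poissonMeasure_singleton, ← ENNReal.ofReal_natCast,
      ← ENNReal.ofReal_coe_nnreal, ← ENNReal.ofReal_mul (by positivity),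
      ← ENNReal.ofReal_mul (by positivity)]
    congr 1
    rw [Nat.factorial_succ]
    push_cast
    field_simp
    ring
  rw [lintegral_countable', tsum_eq_zero_add' ENNReal.summable]
  simp only [hsucc, ENNReal.tsum_mul_left]
  have h1 : ∑' n, poissonMeasure r {n} = 1 := by
    rw [← measure_iUnion (fun i j h => by simpa using h) (fun _ => measurableSet_singleton _),
      iUnion_of_singleton, measure_univ]
  simp [h1]

/-- The expected number of atoms of a set of finite area, as a finite number. -/
noncomputable def meanCount (lam : ℝ≥0) (S : Set Plane) : ℝ≥0 := lam * (volume S).toNNReal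

lemma coe_meanCount {lam : ℝ≥0} {S : Set Plane} (hS : volume S ≠ ∞) :
    (meanCount lam S : ℝ≥0∞) = lam * volume S := by
  rw [meanCount, ENNReal.coe_mul, ENNReal.coe_toNNReal hS]

lemma coe_real_meanCount {lam : ℝ≥0} {S : Set Plane} :
    (meanCount lam S : ℝ) = lam * volume.real S := by
  rw [meanCount, NNReal.coe_mul]; rfl

namespace IsPoissonProcess

variable {Ω : Type*} [MeasurableSpace Ω] {P : Measure Ω} {lam : ℝ≥0} {Φ : Ω → Config}

lemma measurable_count (hΦ : IsPoissonProcess P lam Φ) {S : Set Plane} (hS : MeasurableSet S)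
    (hb : Bornology.IsBounded S) : Measurable fun ω => (Φ ω).count S :=
  (Config.measurable_count hS hb).comp hΦ.measurable

lemma measure_count_mem (hΦ : IsPoissonProcess P lam Φ) {S : Set Plane} (hS : MeasurableSet S)
    (hb : Bornology.IsBounded S) (s : Set ℕ) :
    P ((fun ω => (Φ ω).count S) ⁻¹' s) = poissonMeasure (meanCount lam S) s := by
  rw [meanCount, ← hΦ.law_count S hS hb, Measure.map_apply (hΦ.measurable_count hS hb) (.of_discrete)]

lemma lintegral_count (hΦ : IsPoissonProcess P lam Φ) {S : Set Plane} (hS : MeasurableSet S)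
    (hb : Bornology.IsBounded S) : ∫⁻ ω, ((Φ ω).count S : ℝ≥0∞) ∂P = lam * volume S := by
  rw [← lintegral_map (f := fun n : ℕ => (n : ℝ≥0∞)) .of_discrete (hΦ.measurable_count hS hb),
    hΦ.law_count S hS hb, lintegral_natCast_poissonMeasure, ← coe_meanCount hb.measure_lt_top.ne,
    meanCount]

lemma measurableSet_counts_mem (hΦ : IsPoissonProcess P lam Φ) {S T U : Set Plane}
    (hS : MeasurableSet S) (hT : MeasurableSet T) (hU : MeasurableSet U)
    (hSb : Bornology.IsBounded S) (hTb : Bornology.IsBounded T) (hUb : Bornology.IsBounded U)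
    (s t u : Set ℕ) :
    MeasurableSet {ω | (Φ ω).count S ∈ s ∧ (Φ ω).count T ∈ t ∧ (Φ ω).count U ∈ u} :=
  (hΦ.measurable_count hS hSb .of_discrete).inter
    ((hΦ.measurable_count hT hTb .of_discrete).inter (hΦ.measurable_count hU hUb .of_discrete))

lemma measure_counts_mem (hΦ : IsPoissonProcess P lam Φ) {S T U : Set Plane}
    (hS : MeasurableSet S) (hT : MeasurableSet T) (hU : MeasurableSet U)
    (hSb : Bornology.IsBounded S) (hTb : Bornology.IsBounded T) (hUb : Bornology.IsBounded U)
    (hST : Disjoint S T) (hSU : Disjoint S U) (hTU : Disjoint T U) (s t u : Set ℕ) :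
    P {ω | (Φ ω).count S ∈ s ∧ (Φ ω).count T ∈ t ∧ (Φ ω).count U ∈ u} =
      poissonMeasure (meanCount lam S) s * (poissonMeasure (meanCount lam T) t *
        poissonMeasure (meanCount lam U) u) := by
  have hind := hΦ.indep_count 3 ![S, T, U] (by simp [Fin.forall_fin_succ, hS, hT, hU])
    (by simp [Fin.forall_fin_succ, hSb, hTb, hUb])
    (by intro i j hij; fin_cases i <;> fin_cases j <;> simp_all [disjoint_comm])
  have h := hind.measure_inter_preimage_eq_mul Finset.univ (sets := ![s, t, u])
    (fun _ _ => .of_discrete)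
  have hset : {ω | (Φ ω).count S ∈ s ∧ (Φ ω).count T ∈ t ∧ (Φ ω).count U ∈ u} =
      ⋂ i ∈ (Finset.univ : Finset (Fin 3)),
        (fun ω => (Φ ω).count (![S, T, U] i)) ⁻¹' (![s, t, u] i) := by
    ext ω
    simp [Fin.forall_fin_succ]
  rw [hset, h, Fin.prod_univ_three, mul_assoc, ← hΦ.measure_count_mem hS hSb,
    ← hΦ.measure_count_mem hT hTb, ← hΦ.measure_count_mem hU hUb]
  rfl

lemma measure_pair_le (hΦ : IsPoissonProcess P lam Φ) {S T U : Set Plane}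
    (hS : MeasurableSet S) (hT : MeasurableSet T) (hU : MeasurableSet U)
    (hSb : Bornology.IsBounded S) (hTb : Bornology.IsBounded T) (hUb : Bornology.IsBounded U)
    (hST : Disjoint S T) (hSU : Disjoint S U) (hTU : Disjoint T U) :
    P {ω | (Φ ω).count S ∈ Ici 1 ∧ (Φ ω).count T ∈ Ici 1 ∧ (Φ ω).count U ∈ ({0} : Set ℕ)} ≤
      lam * volume S * (lam * volume T * ENNReal.ofReal (Real.exp (-(lam * volume.real U)))) := by
  rw [hΦ.measure_counts_mem hS hT hU hSb hTb hUb hST hSU hTU, poissonMeasure_zero,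
    coe_real_meanCount, ← coe_meanCount hSb.measure_lt_top.ne, ← coe_meanCount hTb.measure_lt_top.ne]
  gcongr <;> exact poissonMeasure_Ici_one_le _

/-- The factors exp(-lam |S|) and exp(-lam |T|) from the two single-atom events complete the void
probability of the remainder to that of all of `V`. -/
lemma measure_pair_eq (hΦ : IsPoissonProcess P lam Φ) {S T V : Set Plane}
    (hS : MeasurableSet S) (hT : MeasurableSet T) (hV : MeasurableSet V)
    (hVb : Bornology.IsBounded V) (hST : Disjoint S T) (hSV : S ⊆ V) (hTV : T ⊆ V) :
    P {ω | (Φ ω).count S ∈ ({1} : Set ℕ) ∧ (Φ ω).count T ∈ ({1} : Set ℕ) ∧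
        (Φ ω).count (V \ (S ∪ T)) ∈ ({0} : Set ℕ)} =
      lam * volume S * (lam * volume T * ENNReal.ofReal (Real.exp (-(lam * volume.real V)))) := by
  have hSb := hVb.subset hSV
  have hTb := hVb.subset hTV
  rw [hΦ.measure_counts_mem hS hT (hV.diff (hS.union hT)) hSb hTb (hVb.subset sdiff_subset) hST
    (disjoint_sdiff_right.mono_left subset_union_left)
    (disjoint_sdiff_right.mono_left subset_union_right), poissonMeasure_zero, poissonMeasure_one,
    poissonMeasure_one, ← coe_meanCount hSb.measure_lt_top.ne,
    ← coe_meanCount hTb.measure_lt_top.ne, coe_real_meanCount, coe_real_meanCount,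
    coe_real_meanCount,
    measureReal_sdiff (union_subset hSV hTV) (hS.union hT) hVb.measure_lt_top.ne,
    measureReal_union hST hT hSb.measure_lt_top.ne hTb.measure_lt_top.ne]
  have he : Real.exp (-(lam * volume.real V)) = Real.exp (-(lam * volume.real S)) *
      (Real.exp (-(lam * volume.real T)) *
        Real.exp (-(lam * (volume.real V - (volume.real S + volume.real T))))) := by
    rw [← Real.exp_add, ← Real.exp_add]
    ring_nf
  rw [he, ENNReal.ofReal_mul (Real.exp_nonneg _), ENNReal.ofReal_mul (Real.exp_nonneg _)]
  ring

end IsPoissonProcess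

/-! ### Partitions into small cells and the counting of events. -/

/-- A countable measurable partition of the plane into cells, the `k`-th cell lying within distance
`h` of the point `center k`. -/
structure MeshPartition (h : ℝ) where
  /-- the index of the cell of a point -/
  index : Plane → ℕ
  /-- a point near the cell of given index -/
  center : ℕ → Plane
  measurable_index : Measurable index
  dist_center_le : ∀ z, dist z (center (index z)) ≤ h

/-- A point is assigned to the first member of a dense sequence within distance `h`. -/
lemma nonempty_meshPartition {h : ℝ} (hh : 0 < h) : Nonempty (MeshPartition h) := by
  classical
  have hex : ∀ z : Plane, ∃ k, dist z (TopologicalSpace.denseSeq Plane k) < h := fun z =>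
    (TopologicalSpace.denseRange_denseSeq Plane).exists_dist_lt z hh
  refine ⟨⟨fun z => Nat.find (hex z), TopologicalSpace.denseSeq Plane, measurable_find hex
    fun k => (isOpen_lt (by fun_prop) (by fun_prop)).measurableSet, fun z =>
      (Nat.find_spec (hex z)).le⟩⟩

lemma lintegral_eq_tsum_fiber {α ι : Type*} [MeasurableSpace α] [Countable ι] [MeasurableSpace ι]
    [MeasurableSingletonClass ι] {f : α → ι} (hf : Measurable f) (μ : Measure α) (g : α → ℝ≥0∞) :
    ∫⁻ a, g a ∂μ = ∑' i, ∫⁻ a in f ⁻¹' {i}, g a ∂μ := by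
  rw [← lintegral_iUnion (fun i => hf (measurableSet_singleton i))
    (fun i j hij => Disjoint.preimage f (by simpa using hij)), ← preimage_iUnion,
    iUnion_of_singleton, preimage_univ, Measure.restrict_univ]

lemma encard_inter_eq_tsum {α : Type*} (S T : Set α) :
    ((S ∩ T).encard : ℝ≥0∞) = ∑' z : S, T.indicator (fun _ => 1) (z : α) := by
  rw [← ENNReal.tsum_set_one, tsum_subtype (S ∩ T) (fun _ => (1 : ℝ≥0∞)),
    tsum_subtype S (T.indicator fun _ => (1 : ℝ≥0∞)), indicator_indicator]

lemma encard_eq_tsum_indicator {α : Type*} (S : Set α) :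
    (S.encard : ℝ≥0∞) = ∑' z, S.indicator (fun _ => 1) z := by
  rw [← ENNReal.tsum_set_one, tsum_subtype S (fun _ => (1 : ℝ≥0∞))]

lemma encard_eq_tsum_fiber {α ι : Type*} (f : α → ι) (S : Set α) :
    (S.encard : ℝ≥0∞) = ∑' i, ((S ∩ f ⁻¹' {i}).encard : ℝ≥0∞) := by
  classical
  simp only [encard_eq_tsum_indicator]
  rw [ENNReal.tsum_comm]
  refine tsum_congr fun z => ?_
  rw [tsum_eq_single (f z)]
  · simp [indicator_apply]
  · intro i hi
    simp [hi.symm]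

section CountingEvents

variable {Ω ι : Type*} [MeasurableSpace Ω] [Countable ι] {E : ι → Set Ω}

lemma measurable_encard_setOf_mem (hE : ∀ i, MeasurableSet (E i)) :
    Measurable fun ω => ({i | ω ∈ E i}.encard : ℝ≥0∞) := by
  simp only [encard_eq_tsum_indicator]
  exact Measurable.tsum fun i => measurable_const.indicator (hE i)

lemma lintegral_encard_setOf_mem (hE : ∀ i, MeasurableSet (E i)) (P : Measure Ω) :
    ∫⁻ ω, ({i | ω ∈ E i}.encard : ℝ≥0∞) ∂P = ∑' i, P (E i) := by
  simp only [encard_eq_tsum_indicator]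
  change ∫⁻ ω, ∑' i, (E i).indicator (fun _ => (1 : ℝ≥0∞)) ω ∂P = _
  rw [lintegral_tsum fun i => (measurable_const.indicator (hE i)).aemeasurable]
  exact tsum_congr fun i => lintegral_indicator_one (hE i)

end CountingEvents

/-! ### Certain and candidate pairs of cells against paired atoms. -/

namespace MeshPartition

variable {h : ℝ} (𝒬 : MeshPartition h)

/-- The cell of index `k`. -/
def cell (k : ℕ) : Set Plane := 𝒬.index ⁻¹' {k}

variable {𝒬}

lemma mem_cell_index (z : Plane) : z ∈ 𝒬.cell (𝒬.index z) := rfl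

lemma measurableSet_cell (k : ℕ) : MeasurableSet (𝒬.cell k) :=
  𝒬.measurable_index (measurableSet_singleton k)

lemma dist_center_le_of_mem {k : ℕ} {z : Plane} (hz : z ∈ 𝒬.cell k) : dist z (𝒬.center k) ≤ h := by
  obtain rfl : 𝒬.index z = k := hz
  exact 𝒬.dist_center_le z

lemma cell_subset_closedBall (k : ℕ) : 𝒬.cell k ⊆ Metric.closedBall (𝒬.center k) h :=
  fun _ hz => dist_center_le_of_mem hz

lemma isBounded_cell (k : ℕ) : Bornology.IsBounded (𝒬.cell k) :=
  Metric.isBounded_closedBall.subset (cell_subset_closedBall k)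

lemma disjoint_cell {j k : ℕ} (hjk : j ≠ k) : Disjoint (𝒬.cell j) (𝒬.cell k) :=
  Disjoint.preimage _ (by simpa using hjk)

lemma dist_le_of_index_eq {z w : Plane} (hzw : 𝒬.index z = 𝒬.index w) : dist z w ≤ 2 * h := by
  have h1 := dist_triangle_right z w (𝒬.center (𝒬.index z))
  have h2 := 𝒬.dist_center_le z
  have h3 := 𝒬.dist_center_le w
  rw [← hzw] at h3
  linarith

lemma nonneg (𝒬 : MeshPartition h) : 0 ≤ h := dist_nonneg.trans (𝒬.dist_center_le 0)

lemma cell_union_cell_subset_outerDiscs (j k : ℕ) :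
    𝒬.cell j ∪ 𝒬.cell k ⊆ outerDiscs h (𝒬.center j) (𝒬.center k) := by
  have hh := 𝒬.nonneg
  have hd : 0 ≤ dist (𝒬.center j) (𝒬.center k) := dist_nonneg
  exact union_subset_union
    ((cell_subset_closedBall j).trans (Metric.closedBall_subset_closedBall (by linarith)))
    ((cell_subset_closedBall k).trans (Metric.closedBall_subset_closedBall (by linarith)))

variable (𝒬)

/-- Pairs of different cells holding atoms, the first one in `B`, which are not excluded as
positions of mutually nearest neighbours by atoms in other cells. -/
def candidatePairs (B : Set Plane) (φ : Config) : Set (ℕ × ℕ) :=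
  {p | p.1 ≠ p.2 ∧ φ.count (𝒬.cell p.1 ∩ B) ∈ Ici 1 ∧ φ.count (𝒬.cell p.2) ∈ Ici 1 ∧
    φ.count (innerDiscs h (𝒬.center p.1) (𝒬.center p.2) \ (𝒬.cell p.1 ∪ 𝒬.cell p.2)) ∈
      ({0} : Set ℕ)}

/-- Pairs of different cells that hold one atom each, the first one in `B`, which are mutually
nearest neighbours wherever they are in these cells. -/
def certainPairs (B : Set Plane) (φ : Config) : Set (ℕ × ℕ) :=
  {p | p.1 ≠ p.2 ∧ φ.count (𝒬.cell p.1 ∩ B) ∈ ({1} : Set ℕ) ∧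
    φ.count (𝒬.cell p.2) ∈ ({1} : Set ℕ) ∧
    φ.count (outerDiscs h (𝒬.center p.1) (𝒬.center p.2) \ ((𝒬.cell p.1 ∩ B) ∪ 𝒬.cell p.2)) ∈
      ({0} : Set ℕ)}

variable {𝒬} {B : Set Plane} {φ : Config}

lemma exists_of_mem_certainPairs {p : ℕ × ℕ} (hp : p ∈ 𝒬.certainPairs B φ) :
    ∃ z y, z ∈ φ.atoms ∧ y ∈ φ.atoms ∧ y ≠ z ∧ z ∈ B ∧ 𝒬.index z = p.1 ∧ 𝒬.index y = p.2 ∧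
      ∀ w ∈ φ.atoms, w ∈ Metric.closedBall z (dist z y) ∪ Metric.closedBall y (dist z y) →
        w = z ∨ w = y := by
  obtain ⟨hne, h1, h2, h3⟩ := hp
  obtain ⟨z, hz, hzc, hz'⟩ := Config.exists_of_count_eq_one h1
  obtain ⟨y, hy, hyc, hy'⟩ := Config.exists_of_count_eq_one h2
  have h3 := (Config.count_eq_zero_iff (isBounded_outerDiscs.subset sdiff_subset)).1 h3
  refine ⟨z, y, hz, hy, ?_, hzc.2, hzc.1, hyc, fun w hw hwb => ?_⟩
  · rintro rfl
    exact hne (hzc.1.symm.trans hyc)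
  · have hwo := subset_outerDiscs (dist_center_le_of_mem hzc.1) (dist_center_le_of_mem hyc) hwb
    by_contra! hne'
    exact h3 w hw ⟨hwo, fun h => h.elim (fun h => hne'.1 (hz' w hw h)) fun h => hne'.2 (hy' w hw h)⟩

/-- Sending a certain pair to its atom in the first cell is injective: closed discs exclude ties, so
that atom has only one nearest neighbour. -/
lemma encard_certainPairs_le : (𝒬.certainPairs B φ).encard ≤ (φ.paired ∩ B).encard := by
  choose! z y hz hy hne hzB hzi hyi hzy using
    fun p (hp : p ∈ 𝒬.certainPairs B φ) => exists_of_mem_certainPairs hp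
  have hm : ∀ p ∈ 𝒬.certainPairs B φ, φ.MNNR (z p) (y p) := fun p hp =>
    Config.mnnr_iff.2 ⟨hz p hp, hy p hp, hne p hp, fun w hw hwb => hzy p hp w hw
      (union_subset_union Metric.ball_subset_closedBall Metric.ball_subset_closedBall hwb)⟩
  refine encard_le_encard_of_injOn (f := z)
    (fun p hp => ⟨Config.mem_paired_iff.2 ⟨y p, hm p hp⟩, hzB p hp⟩) fun p hp q hq hpq => ?_
  -- Being nearest to the common atom, `y q` lies in the closed disc belonging to `p`, whose only
  -- atoms are `z p` and `y p`.
  have hy_eq : y p = y q := by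
    by_contra hcon
    have h1 : dist (z p) (y q) ≤ dist (z p) (y p) := by
      have := (Config.nnr_iff.1 (hm q hq).1).2.2.2 (y p) (hy p hp) (hpq ▸ hne p hp)
      rwa [← hpq] at this
    rcases hzy p hp (y q) (hy q hq) (Or.inl (by rwa [Metric.mem_closedBall, dist_comm]))
      with h | h
    · exact hne q hq (h.trans hpq)
    · exact hcon h.symm
  exact Prod.ext ((hzi p hp).symm.trans (hpq ▸ hzi q hq))
    ((hyi p hp).symm.trans (hy_eq ▸ hyi q hq))

lemma mem_candidatePairs {z y : Plane} (hz : z ∈ B) (hzy : φ.MNNR z y)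
    (hne : 𝒬.index z ≠ 𝒬.index y) : (𝒬.index z, 𝒬.index y) ∈ 𝒬.candidatePairs B φ := by
  obtain ⟨hzφ, hyφ, -, hw⟩ := Config.mnnr_iff.1 hzy
  refine ⟨hne, (Config.one_le_count_iff ((isBounded_cell _).subset inter_subset_left)).2
    ⟨z, hzφ, mem_cell_index z, hz⟩, (Config.one_le_count_iff (isBounded_cell _)).2
    ⟨y, hyφ, mem_cell_index y⟩, (Config.count_eq_zero_iff
      (isBounded_innerDiscs.subset sdiff_subset)).2 fun w hwφ hwm => hwm.2 ?_⟩
  rcases hw w hwφ (innerDiscs_subset (𝒬.dist_center_le z) (𝒬.dist_center_le y) hwm.1) with rfl | rfl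
  · exact Or.inl (mem_cell_index w)
  · exact Or.inr (mem_cell_index w)

/-- Any finite set of paired atoms is eventually separated by the cells, each atom from the others
and from a chosen partner, so its members yield distinct candidate pairs. Passing to finite subsets
also covers infinite counts. -/
lemma encard_paired_inter_le_liminf {h : ℕ → ℝ} (hh : Filter.Tendsto h Filter.atTop (nhds 0))
    (𝒬 : ∀ n, MeshPartition (h n)) (B : Set Plane) (φ : Config) :
    ((φ.paired ∩ B).encard : ℝ≥0∞) ≤
      Filter.liminf (fun n => (((𝒬 n).candidatePairs B φ).encard : ℝ≥0∞)) Filter.atTop := by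
  rw [← ENNReal.tsum_set_one, ENNReal.tsum_eq_iSup_sum]
  refine iSup_le fun F => Filter.le_liminf_of_le (by isBoundedDefault) ?_
  have hF : ∀ z : ↥(φ.paired ∩ B), ∃ y, φ.MNNR z y := fun z => Config.mem_paired_iff.1 z.2.1
  choose y hy using hF
  have hsep : ∀ a b : Plane, a ≠ b → ∀ᶠ n in Filter.atTop, (𝒬 n).index a ≠ (𝒬 n).index b := by
    intro a b hab
    filter_upwards [hh.eventually_lt_const (half_pos (dist_pos.2 hab))] with n hn heq
    have := dist_le_of_index_eq heq
    linarith
  have h1 : ∀ᶠ n in Filter.atTop, ∀ z ∈ F, (𝒬 n).index z ≠ (𝒬 n).index (y z) :=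
    (Filter.eventually_all_finset F).2 fun z _ => hsep _ _ (Ne.symm (hy z).1.2.1.2)
  have h2 : ∀ᶠ n in Filter.atTop, ∀ z ∈ F, ∀ w ∈ F, z ≠ w →
      (𝒬 n).index z ≠ (𝒬 n).index (w : Plane) := by
    refine (Filter.eventually_all_finset F).2 fun z _ => (Filter.eventually_all_finset F).2
      fun w _ => ?_
    by_cases hzw : z = w
    · simp [hzw]
    · filter_upwards [hsep z w (fun h => hzw (Subtype.ext h))] with n hn _ using hn
  filter_upwards [h1, h2] with n hn1 hn2
  have hle : (F : Set ↥(φ.paired ∩ B)).encard ≤ ((𝒬 n).candidatePairs B φ).encard :=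
    encard_le_encard_of_injOn (f := fun z => ((𝒬 n).index z, (𝒬 n).index (y z)))
      (fun z hz => mem_candidatePairs z.2.2 (hy z) (hn1 z hz)) fun z hz w hw hzw => by
        by_contra hne
        exact hn2 z hz w hw hne (Prod.ext_iff.1 hzw).1
  rw [encard_coe_eq_coe_finsetCard] at hle
  simpa using ENat.toENNReal_le.2 hle

end MeshPartition

/-! ### The Gaussian integral over pairs of points and its split into cells. -/

/-- The probability that a Poisson process of density `lam` has no atoms in a region whose area is
`a` times the squared distance of two points, plus `c`. -/
noncomputable def gaussKernel (lam : ℝ≥0) (a c : ℝ) (p : Plane × Plane) : ℝ≥0∞ :=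
  ENNReal.ofReal (Real.exp (-(lam * (a * dist p.1 p.2 ^ 2 + c))))

lemma measurable_gaussKernel (lam : ℝ≥0) (a c : ℝ) : Measurable (gaussKernel lam a c) := by
  unfold gaussKernel
  fun_prop

lemma lintegral_exp_neg_mul_dist_sq (z : Plane) {b : ℝ} (hb : 0 < b) :
    ∫⁻ y : Plane, ENNReal.ofReal (Real.exp (-(b * dist z y ^ 2))) = ENNReal.ofReal (Real.pi / b) := by
  have h1 : ∫ v : Plane, Real.exp (-b * ‖v‖ ^ 2) = Real.pi / b := by
    rw [GaussianFourier.integral_rexp_neg_mul_sq_norm hb]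
    simp
  have hint : Integrable fun v : Plane => Real.exp (-b * ‖v‖ ^ 2) :=
    .of_integral_ne_zero (by rw [h1]; have := Real.pi_pos; positivity)
  rw [← h1, ofReal_integral_eq_lintegral_ofReal hint (.of_forall fun _ => Real.exp_nonneg _),
    ← lintegral_sub_right_eq_self (fun v : Plane => ENNReal.ofReal (Real.exp (-b * ‖v‖ ^ 2))) z]
  simp only [dist_comm z, dist_eq_norm, neg_mul]

lemma lintegral_gaussKernel {lam : ℝ≥0} (hlam : 0 < lam) {a : ℝ} (ha : 0 < a) (c : ℝ)
    (B : Set Plane) :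
    ∫⁻ p, gaussKernel lam a c p ∂(volume.restrict B).prod volume =
      volume B * ENNReal.ofReal (Real.exp (-(lam * c)) * (Real.pi / (lam * a))) := by
  rw [lintegral_prod _ (measurable_gaussKernel lam a c).aemeasurable]
  have hz : ∀ z : Plane, ∫⁻ y, gaussKernel lam a c (z, y) =
      ENNReal.ofReal (Real.exp (-(lam * c)) * (Real.pi / (lam * a))) := by
    intro z
    rw [ENNReal.ofReal_mul (Real.exp_nonneg _), ← lintegral_exp_neg_mul_dist_sq z (by positivity),
      ← lintegral_const_mul _ (by fun_prop)]
    refine lintegral_congr fun y => ?_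
    rw [gaussKernel, ← ENNReal.ofReal_mul (Real.exp_nonneg _), ← Real.exp_add]
    ring_nf
  simp only [hz, lintegral_const, Measure.restrict_apply_univ, mul_comm]

namespace MeshPartition

variable {h : ℝ} (𝒬 : MeshPartition h)

/-- The pair of indices of the cells of two points. -/
def pairIndex (p : Plane × Plane) : ℕ × ℕ := (𝒬.index p.1, 𝒬.index p.2)

variable {𝒬}

lemma measurable_pairIndex : Measurable 𝒬.pairIndex :=
  (𝒬.measurable_index.comp measurable_fst).prodMk (𝒬.measurable_index.comp measurable_snd)

lemma measurableSet_pairIndex_preimage (p : ℕ × ℕ) : MeasurableSet (𝒬.pairIndex ⁻¹' {p}) :=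
  measurable_pairIndex (measurableSet_singleton p)

lemma prod_pairIndex_preimage (B : Set Plane) (p : ℕ × ℕ) :
    ((volume.restrict B).prod volume) (𝒬.pairIndex ⁻¹' {p}) =
      volume (𝒬.cell p.1 ∩ B) * volume (𝒬.cell p.2) := by
  have hset : 𝒬.pairIndex ⁻¹' {p} = 𝒬.cell p.1 ×ˢ 𝒬.cell p.2 := by
    ext q
    simp [pairIndex, cell, Prod.ext_iff]
  rw [hset, Measure.prod_prod, Measure.restrict_apply (measurableSet_cell _)]

lemma tsum_volume_cell_inter {B : Set Plane} : ∑' k, volume (𝒬.cell k ∩ B) = volume B := by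
  have := lintegral_eq_tsum_fiber 𝒬.measurable_index (volume.restrict B) 1
  simp only [lintegral_one, Pi.one_apply, Measure.restrict_apply_univ] at this
  rw [this]
  exact tsum_congr fun k => (Measure.restrict_apply (measurableSet_cell k)).symm

/-- Two atoms in the same cell are never counted; this bounds what is missed by O(h²). -/
lemma tsum_diagonal_le (B : Set Plane) :
    ∑' p : ℕ × ℕ, (if p.1 = p.2 then volume (𝒬.cell p.1 ∩ B) * volume (𝒬.cell p.2) else 0) ≤
      volume B * ENNReal.ofReal (Real.pi * h ^ 2) := by
  rw [ENNReal.tsum_prod (f := fun j k => if j = k then volume (𝒬.cell j ∩ B) * volume (𝒬.cell k)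
    else 0)]
  simp only [tsum_ite_eq']
  rw [← tsum_volume_cell_inter (𝒬 := 𝒬) (B := B), ← ENNReal.tsum_mul_right]
  refine ENNReal.tsum_le_tsum fun k => ?_
  gcongr
  refine (measure_mono (cell_subset_closedBall k)).trans_eq ?_
  rw [EuclideanSpace.volume_closedBall_fin_two, mul_comm, ← ENNReal.ofReal_pow 𝒬.nonneg,
    ← ENNReal.ofReal_mul Real.pi_pos.le]

end MeshPartition

/-! ### Mean numbers of candidate and certain pairs. -/

namespace IsPoissonProcess

open MeshPartition

variable {Ω : Type*} [MeasurableSpace Ω] {P : Measure Ω} {lam : ℝ≥0} {Φ : Ω → Config}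
  {h : ℝ} {𝒬 : MeshPartition h} {B : Set Plane}

lemma measurableSet_mem_candidatePairs (hΦ : IsPoissonProcess P lam Φ) (hB : MeasurableSet B)
    (p : ℕ × ℕ) : MeasurableSet {ω | p ∈ 𝒬.candidatePairs B (Φ ω)} :=
  (MeasurableSet.const _).inter (hΦ.measurableSet_counts_mem ((measurableSet_cell _).inter hB)
    (measurableSet_cell _)
    (measurableSet_innerDiscs.diff ((measurableSet_cell _).union (measurableSet_cell _)))
    ((isBounded_cell _).subset inter_subset_left) (isBounded_cell _)
    (isBounded_innerDiscs.subset sdiff_subset) _ _ _)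

lemma measurableSet_mem_certainPairs (hΦ : IsPoissonProcess P lam Φ) (hB : MeasurableSet B)
    (p : ℕ × ℕ) : MeasurableSet {ω | p ∈ 𝒬.certainPairs B (Φ ω)} :=
  (MeasurableSet.const _).inter (hΦ.measurableSet_counts_mem ((measurableSet_cell _).inter hB)
    (measurableSet_cell _)
    (measurableSet_outerDiscs.diff
      (((measurableSet_cell _).inter hB).union (measurableSet_cell _)))
    ((isBounded_cell _).subset inter_subset_left) (isBounded_cell _)
    (isBounded_outerDiscs.subset sdiff_subset) _ _ _)

/-- For each pair of cells the probability bound is a constant integrated over the product of the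
cells, and the area estimate dominates that constant by the kernel pointwise. -/
lemma lintegral_encard_candidatePairs_le (hΦ : IsPoissonProcess P lam Φ) (hB : MeasurableSet B) :
    ∫⁻ ω, ((𝒬.candidatePairs B (Φ ω)).encard : ℝ≥0∞) ∂P ≤
      lam ^ 2 * ∫⁻ q, gaussKernel lam (twoDiscArea - 12 * Real.pi * h)
        (-(12 * Real.pi * h + 2 * Real.pi * h ^ 2)) q ∂(volume.restrict B).prod volume := by
  rw [← lintegral_const_mul _ (measurable_gaussKernel _ _ _),
    lintegral_eq_tsum_fiber (measurable_pairIndex (𝒬 := 𝒬))]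
  refine (lintegral_encard_setOf_mem
    (fun p => hΦ.measurableSet_mem_candidatePairs (𝒬 := 𝒬) hB p) P).trans_le
    (ENNReal.tsum_le_tsum fun p => ?_)
  by_cases hp : p.1 = p.2
  · simp [candidatePairs, hp]
  have hset : {ω | p ∈ 𝒬.candidatePairs B (Φ ω)} = {ω | (Φ ω).count (𝒬.cell p.1 ∩ B) ∈ Ici 1 ∧
      (Φ ω).count (𝒬.cell p.2) ∈ Ici 1 ∧
      (Φ ω).count (innerDiscs h (𝒬.center p.1) (𝒬.center p.2) \ (𝒬.cell p.1 ∪ 𝒬.cell p.2)) ∈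
        ({0} : Set ℕ)} := by
    ext ω
    simp [candidatePairs, hp]
  rw [hset]
  refine (hΦ.measure_pair_le ((measurableSet_cell _).inter hB)
    (measurableSet_cell _)
    (measurableSet_innerDiscs.diff ((measurableSet_cell _).union (measurableSet_cell _)))
    ((isBounded_cell _).subset inter_subset_left) (isBounded_cell _)
    (isBounded_innerDiscs.subset sdiff_subset) ((disjoint_cell hp).mono_left inter_subset_left)
    (disjoint_sdiff_right.mono_left (inter_subset_left.trans subset_union_left))
    (disjoint_sdiff_right.mono_left subset_union_right)).trans ?_
  set U := innerDiscs h (𝒬.center p.1) (𝒬.center p.2) \ (𝒬.cell p.1 ∪ 𝒬.cell p.2) with hU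
  calc _ = lam ^ 2 * ENNReal.ofReal (Real.exp (-(lam * volume.real U))) *
        ((volume.restrict B).prod volume) (𝒬.pairIndex ⁻¹' {p}) := by
        rw [prod_pairIndex_preimage]; ring
    _ = ∫⁻ _ in 𝒬.pairIndex ⁻¹' {p}, lam ^ 2 * ENNReal.ofReal (Real.exp (-(lam * volume.real U)))
          ∂(volume.restrict B).prod volume := (setLIntegral_const _ _).symm
    _ ≤ _ := by
        refine setLIntegral_mono' (measurableSet_pairIndex_preimage p) fun q hq => ?_
        have hq' : 𝒬.pairIndex q = p := hq
        have h1 : 𝒬.index q.1 = p.1 := congrArg Prod.fst hq'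
        have h2 : 𝒬.index q.2 = p.2 := congrArg Prod.snd hq'
        have hle := le_volume_real_innerDiscs_diff 𝒬.nonneg (dist_center_le_of_mem h1)
          (dist_center_le_of_mem h2) (union_subset_union (cell_subset_closedBall (𝒬 := 𝒬) p.1)
            (cell_subset_closedBall p.2))
        unfold gaussKernel
        gcongr
        linarith

lemma le_lintegral_encard_certainPairs (hΦ : IsPoissonProcess P lam Φ) (hB : MeasurableSet B) :
    lam ^ 2 * ∫⁻ q, gaussKernel lam (twoDiscArea + 12 * Real.pi * h)
        (12 * Real.pi * h + 72 * Real.pi * h ^ 2) q ∂(volume.restrict B).prod volume ≤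
      ∫⁻ ω, ((𝒬.certainPairs B (Φ ω)).encard : ℝ≥0∞) ∂P +
        lam ^ 2 * (volume B * ENNReal.ofReal (Real.pi * h ^ 2)) := by
  have hh := 𝒬.nonneg
  have hpi := Real.pi_pos
  have hK := twoDiscArea_pos
  grw [← tsum_diagonal_le (𝒬 := 𝒬)]
  rw [← lintegral_const_mul _ (measurable_gaussKernel _ _ _),
    lintegral_eq_tsum_fiber (measurable_pairIndex (𝒬 := 𝒬)), ← ENNReal.tsum_mul_left]
  refine le_of_le_of_eq ?_ (congrArg (· + _) (lintegral_encard_setOf_mem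
    (fun p => hΦ.measurableSet_mem_certainPairs (𝒬 := 𝒬) hB p) P).symm)
  rw [← ENNReal.tsum_add]
  refine ENNReal.tsum_le_tsum fun p => ?_
  by_cases hp : p.1 = p.2
  -- On the diagonal there is no certain pair; the kernel, being at most 1, is paid for by the extra
  -- term.
  · rw [if_pos hp]
    refine le_add_left ?_
    rw [← prod_pairIndex_preimage, ← setLIntegral_const]
    refine setLIntegral_mono' (measurableSet_pairIndex_preimage p) fun q _ => ?_
    refine mul_le_of_le_one_right' ?_
    rw [gaussKernel, ENNReal.ofReal_le_one, Real.exp_le_one_iff, neg_nonpos]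
    positivity
  rw [if_neg hp, mul_zero, add_zero]
  have hset : {ω | p ∈ 𝒬.certainPairs B (Φ ω)} =
      {ω | (Φ ω).count (𝒬.cell p.1 ∩ B) ∈ ({1} : Set ℕ) ∧
      (Φ ω).count (𝒬.cell p.2) ∈ ({1} : Set ℕ) ∧
      (Φ ω).count (outerDiscs h (𝒬.center p.1) (𝒬.center p.2) \
        ((𝒬.cell p.1 ∩ B) ∪ 𝒬.cell p.2)) ∈ ({0} : Set ℕ)} := by
    ext ω
    simp [certainPairs, hp]
  have hsub := cell_union_cell_subset_outerDiscs (𝒬 := 𝒬) p.1 p.2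
  rw [hset, hΦ.measure_pair_eq ((measurableSet_cell _).inter hB) (measurableSet_cell _)
    measurableSet_outerDiscs isBounded_outerDiscs ((disjoint_cell hp).mono_left inter_subset_left)
    ((inter_subset_left.trans subset_union_left).trans hsub) (subset_union_right.trans hsub)]
  set V := outerDiscs h (𝒬.center p.1) (𝒬.center p.2) with hV
  calc _ ≤ ∫⁻ _ in 𝒬.pairIndex ⁻¹' {p}, lam ^ 2 *
        ENNReal.ofReal (Real.exp (-(lam * volume.real V))) ∂(volume.restrict B).prod volume := by
        refine setLIntegral_mono' (measurableSet_pairIndex_preimage p) fun q hq => ?_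
        have hq' : 𝒬.pairIndex q = p := hq
        have h1 : 𝒬.index q.1 = p.1 := congrArg Prod.fst hq'
        have h2 : 𝒬.index q.2 = p.2 := congrArg Prod.snd hq'
        have hle := volume_real_outerDiscs_le hh (dist_center_le_of_mem h1)
          (dist_center_le_of_mem h2)
        unfold gaussKernel
        gcongr
    _ = lam ^ 2 * ENNReal.ofReal (Real.exp (-(lam * volume.real V))) *
        ((volume.restrict B).prod volume) (𝒬.pairIndex ⁻¹' {p}) := setLIntegral_const _ _
    _ = _ := by rw [prod_pairIndex_preimage]; ring

end IsPoissonProcess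

/-! ### Passage to the limit of fine partitions. -/

open Filter Topology in
lemma tendsto_exp_mul_pi_div {lam : ℝ≥0} (hlam : 0 < lam) {h a c : ℕ → ℝ}
    (hh : Tendsto h atTop (𝓝 0))
    (s t : ℝ) (ha : ∀ n, a n = twoDiscArea + s * h n) (hc : ∀ n, c n = s * h n + t * h n ^ 2) :
    Tendsto (fun n => ENNReal.ofReal (Real.exp (-(lam * c n)) * (Real.pi / (lam * a n)))) atTop
      (𝓝 (ENNReal.ofReal (Real.pi / (lam * twoDiscArea)))) := by
  refine ENNReal.tendsto_ofReal ?_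
  have hK := twoDiscArea_pos
  have hl : (0 : ℝ) < lam := hlam
  have ha' : Tendsto a atTop (𝓝 twoDiscArea) := by
    rw [funext ha]
    simpa using (hh.const_mul s).const_add twoDiscArea
  have hc' : Tendsto c atTop (𝓝 0) := by
    rw [funext hc]
    simpa using (hh.const_mul s).add ((hh.pow 2).const_mul t)
  have h1 := ((Real.continuous_exp.tendsto _).comp (hc'.const_mul (lam : ℝ)).neg).mul
    ((tendsto_const_nhds (x := Real.pi)).div (ha'.const_mul (lam : ℝ)) (by positivity))
  simpa using h1

namespace Config

lemma coe_count {φ : Config} {S : Set Plane} (hS : Bornology.IsBounded S) :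
    (φ.count S : ℝ≥0∞) = ((φ.atoms ∩ S).encard : ℝ≥0∞) := by
  rw [count, ← (φ.locallyFinite S hS).cast_ncard_eq]
  rfl

lemma encard_atoms_inter_eq_tsum {h : ℝ} (𝒬 : MeshPartition h) (φ : Config) (B : Set Plane) :
    ((φ.atoms ∩ B).encard : ℝ≥0∞) = ∑' k, (φ.count (𝒬.cell k ∩ B) : ℝ≥0∞) := by
  rw [encard_eq_tsum_fiber 𝒬.index]
  refine tsum_congr fun k => ?_
  rw [coe_count ((MeshPartition.isBounded_cell k).subset inter_subset_left), inter_assoc,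
    inter_comm B]
  rfl

lemma encard_paired_add_encard_singles (φ : Config) (B : Set Plane) :
    ((φ.paired ∩ B).encard : ℝ≥0∞) + ((φ.singles ∩ B).encard : ℝ≥0∞) =
      ((φ.atoms ∩ B).encard : ℝ≥0∞) := by
  have hdisj : Disjoint (φ.paired ∩ B) (φ.singles ∩ B) :=
    disjoint_left.2 fun z hz hz' => (mem_singles_iff.1 hz'.1).2 hz.1
  have hun : φ.paired ∩ B ∪ φ.singles ∩ B = φ.atoms ∩ B := by
    ext z
    have : z ∈ φ.paired → z ∈ φ.atoms := fun h => h.1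
    simp only [mem_union, mem_inter_iff, mem_singles_iff]
    tauto
  rw [← hun, encard_union_eq hdisj, ENat.toENNReal_add]

end Config

namespace IsPoissonProcess

open MeshPartition Filter

variable {Ω : Type*} [MeasurableSpace Ω] {P : Measure Ω} {lam : ℝ≥0} {Φ : Ω → Config}
  {B : Set Plane}

/-- The law of counts concerns bounded sets only, while `B` may be unbounded; summing over bounded
cells bridges the gap. -/
lemma lintegral_encard_atoms (hΦ : IsPoissonProcess P lam Φ) (hB : MeasurableSet B) :
    ∫⁻ ω, (((Φ ω).atoms ∩ B).encard : ℝ≥0∞) ∂P = lam * volume B := by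
  obtain ⟨𝒬⟩ := nonempty_meshPartition one_pos
  have hm : ∀ k, MeasurableSet (𝒬.cell k ∩ B) := fun k => (measurableSet_cell k).inter hB
  have hb : ∀ k, Bornology.IsBounded (𝒬.cell k ∩ B) := fun k =>
    (isBounded_cell k).subset inter_subset_left
  simp only [Config.encard_atoms_inter_eq_tsum 𝒬]
  have hcount : ∀ k, Measurable fun ω => ((Φ ω).count (𝒬.cell k ∩ B) : ℝ≥0∞) := fun k =>
    measurable_from_nat.comp (hΦ.measurable_count (hm k) (hb k))
  rw [lintegral_tsum fun k => (hcount k).aemeasurable]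
  simp only [hΦ.lintegral_count (hm _) (hb _), ENNReal.tsum_mul_left, tsum_volume_cell_inter]

/-- The number of paired atoms lies between measurable functions, the supremum of the certain counts
and the lower limit of the candidate counts. Their integrals agree and are finite, so the three
coincide almost everywhere, which gives measurability and value together. -/
lemma aemeasurable_and_lintegral_encard_paired (hΦ : IsPoissonProcess P lam Φ)
    (hlam : 0 < lam) (hB : MeasurableSet B) (hfin : volume B ≠ ∞) :
    AEMeasurable (fun ω => (((Φ ω).paired ∩ B).encard : ℝ≥0∞)) P ∧
      ∫⁻ ω, (((Φ ω).paired ∩ B).encard : ℝ≥0∞) ∂P =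
        lam ^ 2 * (volume B * ENNReal.ofReal (Real.pi / (lam * twoDiscArea))) := by
  set L : ℝ≥0∞ := lam ^ 2 * (volume B * ENNReal.ofReal (Real.pi / (lam * twoDiscArea))) with hL
  have hpi := Real.pi_pos
  have hK := twoDiscArea_pos
  have hLfin : L ≠ ∞ := ENNReal.mul_ne_top (by simp) (ENNReal.mul_ne_top hfin (by simp))
  set h : ℕ → ℝ := fun n => 1 / ((n : ℝ) + 1) with hh
  have hpos : ∀ n, 0 < h n := fun n => Nat.one_div_pos_of_nat
  have hlim : Tendsto h atTop (nhds 0) := tendsto_one_div_add_atTop_nhds_zero_nat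
  have 𝒬 : ∀ n, MeshPartition (h n) := fun n => (nonempty_meshPartition (hpos n)).some
  set N : ℕ → Ω → ℝ≥0∞ := fun n ω => (((𝒬 n).candidatePairs B (Φ ω)).encard : ℝ≥0∞) with hN
  set M : ℕ → Ω → ℝ≥0∞ := fun n ω => (((𝒬 n).certainPairs B (Φ ω)).encard : ℝ≥0∞) with hM
  have hNm : ∀ n, Measurable (N n) := fun n =>
    measurable_encard_setOf_mem fun p => hΦ.measurableSet_mem_candidatePairs hB p
  have hMm : ∀ n, Measurable (M n) := fun n =>
    measurable_encard_setOf_mem fun p => hΦ.measurableSet_mem_certainPairs hB p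
  have hMle : ∀ ω, (⨆ n, M n ω) ≤ (((Φ ω).paired ∩ B).encard : ℝ≥0∞) := fun ω =>
    iSup_le fun n => ENat.toENNReal_le.2 encard_certainPairs_le
  have hleN : ∀ ω, (((Φ ω).paired ∩ B).encard : ℝ≥0∞) ≤ liminf (fun n => N n ω) atTop := fun ω =>
    encard_paired_inter_le_liminf hlim 𝒬 B (Φ ω)
  have hup : ∫⁻ ω, liminf (fun n => N n ω) atTop ∂P ≤ L := by
    -- Fatou's lemma reduces the bound to the limit of the mean candidate counts.
    refine (lintegral_liminf_le hNm).trans ?_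
    have htend := ENNReal.Tendsto.const_mul (a := (lam : ℝ≥0∞) ^ 2)
      (ENNReal.Tendsto.const_mul (a := volume B)
      (tendsto_exp_mul_pi_div hlam hlim (-(12 * Real.pi)) (-(2 * Real.pi))
        (fun n => rfl) (fun n => rfl)) (Or.inr hfin)) (Or.inr (by simp))
    rw [hL, ← htend.liminf_eq]
    refine liminf_le_liminf ?_
    -- The Gaussian integral needs a positive coefficient, which holds only for fine partitions.
    have hsmall : ∀ᶠ n in atTop, 12 * Real.pi * h n < twoDiscArea :=
      (by simpa using hlim.const_mul (12 * Real.pi) : Tendsto (fun n => 12 * Real.pi * h n) atTop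
        (nhds 0)).eventually_lt_const hK
    filter_upwards [hsmall] with n hn
    refine (hΦ.lintegral_encard_candidatePairs_le hB).trans_eq ?_
    rw [lintegral_gaussKernel hlam (by linarith)]
    ring_nf
  have hlow : L ≤ ∫⁻ ω, ⨆ n, M n ω ∂P := by
    have htend := ENNReal.Tendsto.const_mul (a := (lam : ℝ≥0∞) ^ 2)
      (ENNReal.Tendsto.const_mul (a := volume B)
      (tendsto_exp_mul_pi_div hlam hlim (12 * Real.pi) (72 * Real.pi)
        (fun n => rfl) (fun n => rfl)) (Or.inr hfin)) (Or.inr (by simp))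
    have hzero : Tendsto (fun n => (lam : ℝ≥0∞) ^ 2 * (volume B *
        ENNReal.ofReal (Real.pi * h n ^ 2))) atTop (nhds 0) := by
      have h1 : Tendsto (fun n => Real.pi * h n ^ 2) atTop (nhds 0) := by
        simpa using (hlim.pow 2).const_mul Real.pi
      simpa using ENNReal.Tendsto.const_mul (a := (lam : ℝ≥0∞) ^ 2)
        (ENNReal.Tendsto.const_mul (a := volume B) (ENNReal.tendsto_ofReal h1) (Or.inr hfin))
        (Or.inr (by simp))
    refine le_of_tendsto_of_tendsto' htend
      (by simpa using hzero.const_add (∫⁻ ω, ⨆ n, M n ω ∂P)) fun n => ?_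
    have hle := hΦ.le_lintegral_encard_certainPairs (𝒬 := 𝒬 n) hB
    rw [lintegral_gaussKernel hlam (by have := hpos n; positivity)] at hle
    refine le_trans hle ?_
    gcongr with ω
    exact le_iSup (fun n => M n ω) n
  have hae : (fun ω => ⨆ n, M n ω) =ᵐ[P] fun ω => liminf (fun n => N n ω) atTop :=
    ae_eq_of_ae_le_of_lintegral_le (.of_forall fun ω => (hMle ω).trans (hleN ω))
      ((lintegral_mono fun ω => (hMle ω).trans (hleN ω)).trans_lt
        (hup.trans_lt hLfin.lt_top)).ne
      (Measurable.liminf hNm).aemeasurable (hup.trans hlow)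
  refine ⟨⟨_, Measurable.iSup hMm, ?_⟩, le_antisymm ((lintegral_mono hleN).trans hup)
    (hlow.trans (lintegral_mono hMle))⟩
  filter_upwards [hae] with ω hω
  exact le_antisymm ((hleN ω).trans hω.ge) (hMle ω)

lemma aemeasurable_encard_paired (hΦ : IsPoissonProcess P lam Φ) (hlam : 0 < lam)
    (hB : MeasurableSet B) (hfin : volume B ≠ ∞) :
    AEMeasurable (fun ω => (((Φ ω).paired ∩ B).encard : ℝ≥0∞)) P :=
  (hΦ.aemeasurable_and_lintegral_encard_paired hlam hB hfin).1

lemma lintegral_encard_paired (hΦ : IsPoissonProcess P lam Φ) (hlam : 0 < lam)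
    (hB : MeasurableSet B) (hfin : volume B ≠ ∞) :
    ∫⁻ ω, (((Φ ω).paired ∩ B).encard : ℝ≥0∞) ∂P =
      ENNReal.ofReal (1 / (2 - mnnGamma)) * (lam * volume B) := by
  have hpi := Real.pi_pos
  have hg : 0 < 2 - mnnGamma := (mul_pos_iff_of_pos_left hpi).1 (twoDiscArea_eq ▸ twoDiscArea_pos)
  have hl : (0 : ℝ) < lam := hlam
  rw [(hΦ.aemeasurable_and_lintegral_encard_paired hlam hB hfin).2, twoDiscArea_eq,
    show Real.pi / (lam * (Real.pi * (2 - mnnGamma))) = (lam : ℝ)⁻¹ * (1 / (2 - mnnGamma)) by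
      field_simp, ENNReal.ofReal_mul (by positivity), ENNReal.ofReal_inv_of_pos hl,
    ENNReal.ofReal_coe_nnreal]
  have hc : (lam : ℝ≥0∞) * (lam : ℝ≥0∞)⁻¹ = 1 := ENNReal.mul_inv_cancel (by simpa using hlam.ne')
    (by simp)
  calc _ = (lam : ℝ≥0∞) * (lam : ℝ≥0∞)⁻¹ *
        (ENNReal.ofReal (1 / (2 - mnnGamma)) * (lam * volume B)) := by ring
    _ = _ := by rw [hc, one_mul]

/-- Paired and single atoms add up to all atoms, and additivity of the integral needs measurability
of the paired count alone. -/
lemma lintegral_encard_singles (hΦ : IsPoissonProcess P lam Φ) (hlam : 0 < lam)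
    (hB : MeasurableSet B) (hfin : volume B ≠ ∞) :
    ∫⁻ ω, (((Φ ω).singles ∩ B).encard : ℝ≥0∞) ∂P =
      ENNReal.ofReal (1 - 1 / (2 - mnnGamma)) * (lam * volume B) := by
  have hadd := lintegral_add_left' (hΦ.aemeasurable_encard_paired hlam hB hfin)
    fun ω => (((Φ ω).singles ∩ B).encard : ℝ≥0∞)
  have hδ := abs_lt.1 abs_one_div_two_sub_mnnGamma_sub_lt
  have hfin' : (lam : ℝ≥0∞) * volume B ≠ ∞ := ENNReal.mul_ne_top (by simp) hfin
  simp only [Config.encard_paired_add_encard_singles] at hadd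
  rw [hΦ.lintegral_encard_atoms hB, hΦ.lintegral_encard_paired hlam hB hfin] at hadd
  rw [ENNReal.ofReal_sub _ (by linarith), ENNReal.sub_mul (fun _ _ => hfin'), ENNReal.ofReal_one,
    one_mul]
  exact ENNReal.eq_sub_of_add_eq (ENNReal.mul_ne_top (by simp) hfin')
    (by rw [add_comm]; exact hadd.symm)

/-- Moving `z` to `x` turns the event into a property of `z` in the original configuration, so the
Palm sum counts the atoms of that kind in `B`. -/
lemma palmProb_eq (hΦ : IsPoissonProcess P lam Φ) (hB : MeasurableSet B) {x : Plane}
    {T : Config → Set Plane} (hT : ∀ φ, T φ ⊆ φ.atoms)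
    (htrans : ∀ φ z, x ∈ T (φ.translate (x - z)) ↔ z ∈ T φ) :
    palmProb P Φ B x {φ | x ∈ T φ} =
      (∫⁻ ω, ((T (Φ ω) ∩ B).encard : ℝ≥0∞) ∂P) / (lam * volume B) := by
  rw [palmProb, hΦ.lintegral_encard_atoms hB]
  congr 1
  refine lintegral_congr fun ω => ?_
  have hset : T (Φ ω) ∩ B = ((Φ ω).atoms ∩ B) ∩ T (Φ ω) := by
    rw [inter_assoc, inter_comm B, ← inter_assoc, inter_eq_right.2 (hT _)]
  rw [hset, encard_inter_eq_tsum]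
  refine tsum_congr fun z => ?_
  by_cases hz : (z : Plane) ∈ T (Φ ω)
  · rw [indicator_of_mem hz]
    exact if_pos ((htrans _ _).2 hz)
  · rw [indicator_of_notMem hz]
    exact if_neg fun h => hz ((htrans _ _).1 h)

end IsPoissonProcess

/-! ### The Palm probabilities. -/

theorem theorem1 :
    ∃ δ : ℝ, 0 < δ ∧ δ = 1 / (2 - mnnGamma) ∧ |δ - 0.6215| < 0.00005 ∧
      ∀ (lam : ℝ≥0) (x : Plane), 0 < lam →
        MeasurableSet {φ : Config | x ∈ φ.paired} ∧
        MeasurableSet {φ : Config | x ∈ φ.singles} ∧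
        ∀ {Ω : Type*} [MeasurableSpace Ω] (P : Measure Ω) [IsProbabilityMeasure P]
          (Φ : Ω → Config), IsPoissonProcess P lam Φ →
          ∀ B : Set Plane, MeasurableSet B → 0 < volume B → volume B < ∞ →
            palmProb P Φ B x {φ | x ∈ φ.paired} = ENNReal.ofReal δ ∧
            palmProb P Φ B x {φ | x ∈ φ.singles} = ENNReal.ofReal (1 - δ) := by
  have hδ := abs_lt.1 abs_one_div_two_sub_mnnGamma_sub_lt
  refine ⟨1 / (2 - mnnGamma), by linarith, rfl, abs_one_div_two_sub_mnnGamma_sub_lt,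
    fun lam x hlam => ⟨Config.measurableSet_mem_paired x, Config.measurableSet_mem_singles x, ?_⟩⟩
  intro Ω _ P _ Φ hΦ B hB hpos hfin
  have h0 : (lam : ℝ≥0∞) * volume B ≠ 0 := mul_ne_zero (by simpa using hlam.ne') hpos.ne'
  have htop : (lam : ℝ≥0∞) * volume B ≠ ∞ := ENNReal.mul_ne_top (by simp) hfin.ne
  rw [hΦ.palmProb_eq hB (T := Config.paired) (fun _ _ h => h.1)
      (fun _ _ => Config.mem_paired_translate_iff),
    hΦ.palmProb_eq hB (T := Config.singles) (fun _ _ h => h.1)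
      (fun _ _ => Config.mem_singles_translate_iff),
    hΦ.lintegral_encard_paired hlam hB hfin.ne, hΦ.lintegral_encard_singles hlam hB hfin.ne]
  exact ⟨ENNReal.mul_div_cancel_right h0 htop, ENNReal.mul_div_cancel_right h0 htop⟩
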